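/- Let $c:[0,\infty)\to\mathbb{R}$ be a Lebesgue measurable function and $\psi(t,x):=\mathbf 1_{(-\infty,c(t)]}(x)$. For an integer $s\ge 0$ equip $H^s=H^s(\mathbb{R})$ with the norm $\|f\|_{H^s}=\big(\sum_{k=0}^s\|\partial_x^k f\|_{L^2}^2\big)^{1/2}$. Then for every $u_0\in H^1$ the Cauchy problem $$\partial_t u-\tfrac12\,\partial_x^2u=-\psi u \ \text{ on } [0,\infty)\times\mathbb{R},\qquad u(0,\cdot)=u_0,$$ has a unique weak solution $u$ that is continuous from $[0,\infty)$ to $H^1$ and belongs to $L^2([0,T];H^2)$ for every $T>0$. Here $u$ is a weak solution if $u(0,\cdot)=u_0$ and, for every $T>0$ and every $\phi\in C_c^\infty([0,T]\times\mathbb{R})$, $$\int_0^T\!\!\int_{\mathbb{R}} u\,\partial_t\phi\,dx\,dt=\int_{\mathbb{R}} u(T,x)\phi(T,x)\,dx-\int_{\mathbb{R}} u_0(x)\phi(0,x)\,dx-\frac12\int_0^T\!\!\int_{\mathbb{R}} u\,\partial_x^2\phi\,dx\,dt+\int_0^T\!\!\int_{\mathbb{R}} \psi u\phi\,dx\,dt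 .$$ Furthermore, for every $T>0$ the solution satisfies $$\sup_{0\le t\le T}\|u(t)\|_{H^1}+\Big(\int_0^T\|\partial_xu(t)\|_{H^1}^2\,dt\Big)^{1/2}\le 3\,\|u_0\|_{H^1}.$$ -/

import Mathlib

open MeasureTheory Set
open scoped ENNReal ContDiff

/-- The real Hilbert space `L²(ℝ)` for Lebesgue measure. -/
abbrev L2R : Type := Lp ℝ 2 (volume : Measure ℝ)

/-- `g` is the weak (distributional) derivative of `f`, both in `L²(ℝ)`. -/
def IsWeakDeriv (f g : L2R) : Prop :=
  ∀ η : ℝ → ℝ, ContDiff ℝ ∞ η → HasCompactSupport η →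
    ∫ x, f x * deriv η x = -∫ x, g x * η x

theorem L2R.integrable_mul (f : L2R) {η : ℝ → ℝ} (hη : Continuous η)
    (hc : HasCompactSupport η) : Integrable (fun x => f x * η x) :=
  (Lp.memLp f).integrable_mul (hη.memLp_of_hasCompactSupport (p := 2) hc)

theorem IsWeakDeriv.zero : IsWeakDeriv 0 0 := by
  intro η _ _
  have h1 : ∀ θ : ℝ → ℝ, ∫ x, (0 : L2R) x * θ x = 0 := by
    intro θ
    rw [← integral_zero ℝ ℝ (μ := volume)]
    refine integral_congr_ae ?_
    filter_upwards [Lp.coeFn_zero ℝ 2 (volume : Measure ℝ)] with x hx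
    rw [hx, Pi.zero_apply, zero_mul]
  rw [h1, h1, neg_zero]

theorem IsWeakDeriv.add {f₁ g₁ f₂ g₂ : L2R} (h₁ : IsWeakDeriv f₁ g₁)
    (h₂ : IsWeakDeriv f₂ g₂) : IsWeakDeriv (f₁ + f₂) (g₁ + g₂) := by
  intro η hη hc
  have key : ∀ (a b : L2R) (θ : ℝ → ℝ), Continuous θ → HasCompactSupport θ →
      ∫ x, (a + b : L2R) x * θ x = (∫ x, a x * θ x) + ∫ x, b x * θ x := by
    intro a b θ hθ hθc
    rw [← integral_add (L2R.integrable_mul a hθ hθc) (L2R.integrable_mul b hθ hθc)]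
    refine integral_congr_ae ?_
    filter_upwards [Lp.coeFn_add a b] with x hx
    rw [hx, Pi.add_apply, add_mul]
  rw [key f₁ f₂ _ (hη.continuous_deriv (by simp)) hc.deriv, key g₁ g₂ _ hη.continuous hc,
    h₁ η hη hc, h₂ η hη hc]
  ring

theorem IsWeakDeriv.smul {f g : L2R} (r : ℝ) (h : IsWeakDeriv f g) :
    IsWeakDeriv (r • f) (r • g) := by
  intro η hη hc
  have key : ∀ (a : L2R) (θ : ℝ → ℝ),
      ∫ x, (r • a : L2R) x * θ x = r * ∫ x, a x * θ x := by
    intro a θ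
    rw [← integral_const_mul]
    refine integral_congr_ae ?_
    filter_upwards [Lp.coeFn_smul r a] with x hx
    simp [hx, mul_assoc]
  rw [key, key, h η hη hc]
  ring

/-- The Sobolev space `H^s(ℝ)` for an integer `s ≥ 0`. A function `f` is stored together with its
weak derivatives, as the tuple `(f, ∂ₓf, …, ∂ₓ^s f)` of elements of `L²(ℝ)`; the tuple is determined
by its entry `0`, the function itself. The norm inherited from the `ℓ²`-product is
`‖f‖_{H^s} = (∑_{k ≤ s} ‖∂ₓ^k f‖_{L²}²)^{1/2}`. -/
def Sobolev (s : ℕ) : Submodule ℝ (PiLp 2 fun _ : Fin (s + 1) => L2R) where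
  carrier := {f | ∀ i : Fin s, IsWeakDeriv (f i.castSucc) (f i.succ)}
  zero_mem' := fun _ => IsWeakDeriv.zero
  add_mem' := fun ha hb i => (ha i).add (hb i)
  smul_mem' := fun r _ ha i => (ha i).smul r

/-- The element of `L²(ℝ)` underlying an element of `H^s(ℝ)`. -/
def Sobolev.fn {s : ℕ} (f : Sobolev s) : L2R := f.1 0

/-- The weak derivative `∂ₓ : H^{s+1}(ℝ) → H^s(ℝ)`. -/
noncomputable def Sobolev.dx {s : ℕ} (f : Sobolev (s + 1)) : Sobolev s :=
  ⟨WithLp.toLp 2 fun i => f.1 i.succ, fun i => f.2 i.succ⟩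

/-- For almost every `t ≥ 0`, the function `u t ∈ H¹(ℝ)` is in `H²(ℝ)`, and `w t` is this function
as an element of `H²(ℝ)`. -/
def IsH2Version (u : ℝ → Sobolev 1) (w : ℝ → Sobolev 2) : Prop :=
  ∀ᵐ t ∂(volume.restrict (Ici (0 : ℝ))), Sobolev.fn (w t) = Sobolev.fn (u t)

/-- `u ∈ L²([0,T]; H²(ℝ))` for every `T > 0`. -/
def MemL2H2 (u : ℝ → Sobolev 1) : Prop :=
  ∃ w : ℝ → Sobolev 2, IsH2Version u w ∧
    ∀ T : ℝ, 0 < T → MemLp w 2 (volume.restrict (Icc 0 T))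

/-- The potential `ψ(t,x) = 1_{(-∞, c(t)]}(x)`. -/
noncomputable def killing (c : ℝ → ℝ) (t x : ℝ) : ℝ := (Iic (c t)).indicator (fun _ => 1) x

/-- The equation `∂ₜu - ½ ∂ₓ²u = -1_{(-∞, c(t)]} u` on `[0,∞) × ℝ` with initial value `u₀` in the
sense of distributions: on every `[0,T] × ℝ`, tested with smooth compactly supported functions
that need not vanish at `t = 0` or `t = T`. -/
def IsWeakSolution (c : ℝ → ℝ) (u₀ : Sobolev 1) (u : ℝ → Sobolev 1) : Prop :=
  ∀ T : ℝ, 0 < T → ∀ φ : ℝ → ℝ → ℝ,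
    ContDiff ℝ ∞ (Function.uncurry φ) → HasCompactSupport (Function.uncurry φ) →
    ∫ t in (0 : ℝ)..T, ∫ x, Sobolev.fn (u t) x * deriv (fun s => φ s x) t =
      (∫ x, Sobolev.fn (u T) x * φ T x) - (∫ x, Sobolev.fn u₀ x * φ 0 x)
        - (1 / 2) * (∫ t in (0 : ℝ)..T, ∫ x, Sobolev.fn (u t) x * iteratedDeriv 2 (φ t) x)
        + ∫ t in (0 : ℝ)..T, ∫ x, killing c t x * Sobolev.fn (u t) x * φ t x

/-- `u` is a solution of the Cauchy problem with initial value `u₀` in the class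
`C([0,∞); H¹(ℝ)) ∩ L²([0,∞); H²(ℝ))`, where the second space is local in time. Only the values
`u t` with `t ≥ 0` matter. -/
structure IsSolution (c : ℝ → ℝ) (u₀ : Sobolev 1) (u : ℝ → Sobolev 1) : Prop where
  continuousOn : ContinuousOn u (Ici 0)
  memL2H2 : MemL2H2 u
  initial : u 0 = u₀
  weak : IsWeakSolution c u₀ u

/-! Writing u = e^{2t} v turns the equation into ∂ₜv - ½∂ₓ²v + 2v + ψv = 0, which is dissipative
enough to be treated on all of [0,∞) at once. Existence is then a density argument in Hilbert
spaces. To a trajectory V, continuously differentiable in time with values in H² and zero for large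
times, assign its data (V(0), ∂ₜV - ½∂ₓ²V + 2V + ψV) in H¹ × L²([0,∞); L²). If the data are dense
and control V in C([0,∞); H¹) ∩ L²([0,∞); H²), then trajectories whose data tend to (u₀, 0) form a
Cauchy sequence, and their limit v gives the solution (`exists_isApproximation`,
`IsApproximation.isSolution`).

Density without ψ (`eq_zero_of_forall_inner_data`): if (b, g) is orthogonal to all data, then y = (1
- ∂ₓ²)⁻¹g solves y' = (2 - ½∂ₓ²)y with y(0) = b. Hence ‖y‖² is nondecreasing and integrable on
[0,∞), so y = 0. The potential is then added as a perturbation (`Trajectory.denseRange_data`): the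
shift by 2 makes the map from the data without ψ to ψV a strict contraction.

The a priori estimate (`Trajectory.inner_incl_deriv_le`) pairs the equation with v - ∂ₓ²v, so ψ is
never differentiated and measurability of c suffices. The bad term satisfies 2⟪∂ₓ²v, ψv⟫ ≤ ½‖∂ₓ²v‖²
+ 2‖ψv‖². Diffusion absorbs the first summand, and since ψ² = ψ the second cancels against -2⟪v, ψv⟫
= -2‖ψv‖². In terms of u this gives ‖u(t)‖² + ½∫₀ᵗ‖∂ₓu‖² ≤ ‖u₀‖² with H¹ norms, so the supremum is
at most ‖u₀‖ and the square root of the integral at most √2‖u₀‖, with sum below 3‖u₀‖.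

Uniqueness (`IsSolution.eqOn`): a weak solution satisfies the integrated equation in L², so the
difference d of two solutions has ‖d(T)‖² = 2∫⟪d, ½∂ₓ²d - ψd⟫ ≤ 0. The estimate for an arbitrary
solution is inherited from the constructed one. -/

open Filter Topology

open scoped RealInnerProductSpace

/-! ### Test functions and weak derivatives -/

/-- The class in `L²(ℝ)` of a compactly supported continuous function. -/
noncomputable def L2R.ofTest (η : ℝ → ℝ) (hη : Continuous η) (hc : HasCompactSupport η) : L2R :=
  (hη.memLp_of_hasCompactSupport (p := 2) (μ := volume) hc).toLp η

theorem L2R.inner_eq_integral (f g : L2R) : ⟪f, g⟫ = ∫ x, f x * g x := by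
  rw [MeasureTheory.L2.inner_def]
  refine integral_congr_ae (Eventually.of_forall fun x => ?_)
  simp [mul_comm]

theorem L2R.inner_ofTest (f : L2R) {η : ℝ → ℝ} (hη : Continuous η) (hc : HasCompactSupport η) :
    ⟪f, L2R.ofTest η hη hc⟫ = ∫ x, f x * η x := by
  rw [L2R.inner_eq_integral]
  refine integral_congr_ae ?_
  filter_upwards [(hη.memLp_of_hasCompactSupport (p := 2) (μ := volume) hc).coeFn_toLp] with x hx
  simp only [L2R.ofTest, hx]

/-- Expresses weak differentiability by continuous linear conditions on `L2R`, so that uniqueness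
and closedness become Hilbert space facts. -/
theorem isWeakDeriv_iff {f g : L2R} : IsWeakDeriv f g ↔
    ∀ (η : ℝ → ℝ) (hη : ContDiff ℝ ∞ η) (hc : HasCompactSupport η),
      ⟪f, L2R.ofTest (deriv η) (hη.continuous_deriv (by simp)) hc.deriv⟫ =
        -⟪g, L2R.ofTest η hη.continuous hc⟫ := by
  simp only [IsWeakDeriv, L2R.inner_ofTest]

theorem L2R.eq_zero_of_forall_inner_ofTest (z : L2R)
    (h : ∀ (η : ℝ → ℝ) (hη : ContDiff ℝ ∞ η) (hc : HasCompactSupport η),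
      ⟪z, L2R.ofTest η hη.continuous hc⟫ = 0) : z = 0 := by
  have hd : Dense {f : L2R | ∃ g : ℝ → ℝ, f =ᵐ[volume] g ∧ HasCompactSupport g ∧ ContDiff ℝ ∞ g} :=
    Lp.dense_hasCompactSupport_contDiff (by simp)
  refine hd.eq_zero_of_inner_left (𝕜 := ℝ) ?_
  rintro v ⟨g, hg, hc, hs⟩
  have : v = L2R.ofTest g hs.continuous hc := by
    apply Lp.ext
    filter_upwards [hg, (hs.continuous.memLp_of_hasCompactSupport (p := 2) (μ := volume)
      hc).coeFn_toLp] with x h1 h2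
    rw [h1, L2R.ofTest, h2]
  rw [this]
  exact h g hs hc

theorem IsWeakDeriv.unique {f g g' : L2R} (h : IsWeakDeriv f g) (h' : IsWeakDeriv f g') :
    g = g' := by
  rw [← sub_eq_zero]
  refine L2R.eq_zero_of_forall_inner_ofTest _ fun η hη hc => ?_
  rw [inner_sub_left]
  linarith [isWeakDeriv_iff.1 h η hη hc, isWeakDeriv_iff.1 h' η hη hc]

theorem isWeakDeriv_ofTest {η : ℝ → ℝ} (hη : ContDiff ℝ ∞ η) (hc : HasCompactSupport η) :
    IsWeakDeriv (L2R.ofTest η hη.continuous hc)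
      (L2R.ofTest (deriv η) (hη.continuous_deriv (by simp)) hc.deriv) := by
  rw [isWeakDeriv_iff]
  intro θ hθ hθc
  have hη' := hη.continuous_deriv (by simp)
  have hθ' := hθ.continuous_deriv (by simp)
  rw [real_inner_comm, L2R.inner_ofTest, real_inner_comm _ (L2R.ofTest (deriv η) _ _),
    L2R.inner_ofTest]
  have e1 : ∫ x, (L2R.ofTest (deriv θ) hθ' hθc.deriv) x * η x = ∫ x, η x * deriv θ x := by
    refine integral_congr_ae ?_
    filter_upwards [(hθ'.memLp_of_hasCompactSupport (p := 2) (μ := volume)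
      hθc.deriv).coeFn_toLp] with x hx
    rw [L2R.ofTest, hx, mul_comm]
  have e2 : ∫ x, (L2R.ofTest θ hθ.continuous hθc) x * deriv η x = ∫ x, deriv η x * θ x := by
    refine integral_congr_ae ?_
    filter_upwards [(hθ.continuous.memLp_of_hasCompactSupport (p := 2) (μ := volume)
      hθc).coeFn_toLp] with x hx
    rw [L2R.ofTest, hx, mul_comm]
  rw [e1, e2]
  exact integral_mul_deriv_eq_deriv_mul_of_integrable
    (fun x _ => (hη.differentiable (by simp) x).hasDerivAt)
    (fun x _ => (hθ.differentiable (by simp) x).hasDerivAt)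
    ((hη.continuous.mul hθ').integrable_of_hasCompactSupport hc.mul_right)
    ((hη'.mul hθ.continuous).integrable_of_hasCompactSupport hθc.mul_left)
    ((hη.continuous.mul hθ.continuous).integrable_of_hasCompactSupport hc.mul_right)

theorem L2R.norm_ofTest_translate {χ : ℝ → ℝ} (hχ : Continuous χ) (hc : HasCompactSupport χ)
    (h : ℝ) (hχ' : Continuous fun x => χ (x - h)) (hc' : HasCompactSupport fun x => χ (x - h)) :
    ‖L2R.ofTest (fun x => χ (x - h)) hχ' hc'‖ = ‖L2R.ofTest χ hχ hc‖ := by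
  rw [L2R.ofTest, L2R.ofTest, Lp.norm_toLp, Lp.norm_toLp]
  congr 1
  exact eLpNorm_comp_measurePreserving hχ.aestronglyMeasurable (measurePreserving_sub_right volume h)

/-- The hypothesis says z' = σz weakly, and no nonzero multiple of e^{σx} is square integrable. The
equation η' + ση = χ need not have a compactly supported solution, because ∫ e^{σs}χ(s) ds may be
nonzero; subtracting a weighted translate of χ removes this obstruction and relates ⟪z, χ⟫ to its
translate by a factor e^{-σa}. -/
theorem L2R.eq_zero_of_forall_integral_deriv_add (z : L2R) (σ : ℝ) (hσ : σ ≠ 0)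
    (h : ∀ η : ℝ → ℝ, ContDiff ℝ ∞ η → HasCompactSupport η →
      ∫ x, z x * (deriv η x + σ * η x) = 0) : z = 0 := by
  refine L2R.eq_zero_of_forall_inner_ofTest _ fun χ hχ hc => ?_
  -- the solution of `η' + σ η = χ - e^{-σ a} χ(· - a)` has compact support
  have key : ∀ a : ℝ, |⟪z, L2R.ofTest χ hχ.continuous hc⟫| ≤
      Real.exp (-(σ * a)) * (‖z‖ * ‖L2R.ofTest χ hχ.continuous hc‖) := by
    intro a
    have hcm : HasCompactSupport fun x => χ (x - a) := hc.comp_homeomorph (Homeomorph.subRight a)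
    have hχm : ContDiff ℝ ∞ fun x => χ (x - a) := hχ.comp (contDiff_id.sub contDiff_const)
    set ρ : ℝ → ℝ := fun s => Real.exp (σ * s) * χ s with hρ
    have hρs : ContDiff ℝ ∞ ρ := (Real.contDiff_exp.comp (contDiff_const.mul contDiff_id)).mul hχ
    have hρc : HasCompactSupport ρ := hc.mul_left
    set ζ : ℝ → ℝ := fun x => (∫ s in (0 : ℝ)..x, ρ s) - ∫ s in (0 : ℝ)..(x - a), ρ s with hζ
    have hζd : ∀ x, HasDerivAt ζ (ρ x - ρ (x - a)) x := by
      intro x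
      have h1 := hρs.continuous.integral_hasStrictDerivAt 0 x |>.hasDerivAt
      have h2 := (hρs.continuous.integral_hasStrictDerivAt 0 (x - a)).hasDerivAt.comp x
        ((hasDerivAt_id x).sub_const a)
      rw [mul_one] at h2
      exact h1.sub h2
    have hζs : ContDiff ℝ ∞ ζ := by
      rw [contDiff_infty_iff_deriv]
      refine ⟨fun x => (hζd x).differentiableAt, ?_⟩
      rw [show deriv ζ = fun x => ρ x - ρ (x - a) from funext fun x => (hζd x).deriv]
      exact hρs.sub (hρs.comp (contDiff_id.sub contDiff_const))
    have hζc : HasCompactSupport ζ := by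
      obtain ⟨R, hR⟩ := hρc.isCompact.isBounded.subset_closedBall 0
      have hz : ∀ s, R < |s| → ρ s = 0 := by
        intro s hs
        by_contra hne
        have := hR (subset_tsupport _ hne)
        simp at this
        linarith
      refine HasCompactSupport.intro (isCompact_Icc (a := -(|R| + |a|)) (b := |R| + |a|)) ?_
      intro x hx
      have e : ζ x = ∫ s in (x - a)..x, ρ s := by
        rw [hζ]
        exact intervalIntegral.integral_interval_sub_left
          (hρs.continuous.intervalIntegrable _ _) (hρs.continuous.intervalIntegrable _ _)
      rw [e]
      rw [intervalIntegral.integral_congr (g := fun _ => (0 : ℝ)), intervalIntegral.integral_zero]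
      intro s hs
      refine hz s ?_
      rw [mem_Icc, not_and_or] at hx
      have ha := neg_abs_le a
      have ha' := le_abs_self a
      have hr := le_abs_self R
      rcases hx with hx | hx
      · have : s ≤ max (x - a) x := hs.2
        have : s < -|R| := by
          rcases max_choice (x - a) x with h | h <;> rw [h] at this <;> linarith
        rw [abs_of_neg (by linarith [abs_nonneg R])]
        linarith
      · have : min (x - a) x ≤ s := hs.1
        have : |R| < s := by
          rcases min_choice (x - a) x with h | h <;> rw [h] at this <;> linarith
        exact lt_of_le_of_lt hr (lt_of_lt_of_le this (le_abs_self s))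
    have hes : ContDiff ℝ ∞ fun x : ℝ => Real.exp (-(σ * x)) :=
      Real.contDiff_exp.comp (contDiff_const.mul contDiff_id).neg
    have hηs : ContDiff ℝ ∞ fun x => Real.exp (-(σ * x)) * ζ x := hes.mul hζs
    have hηc : HasCompactSupport fun x => Real.exp (-(σ * x)) * ζ x := hζc.mul_left
    have hη := h _ hηs hηc
    have heq : ∀ x, deriv (fun x => Real.exp (-(σ * x)) * ζ x) x + σ * (Real.exp (-(σ * x)) * ζ x)
        = χ x - Real.exp (-(σ * a)) * χ (x - a) := by
      intro x
      have hd : HasDerivAt (fun x => Real.exp (-(σ * x)))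
          (Real.exp (-(σ * x)) * (-(σ * 1))) x :=
        (((hasDerivAt_id x).const_mul σ).neg).exp
      rw [(hd.fun_mul (hζd x)).deriv]
      have e1 : Real.exp (-(σ * x)) * ρ x = χ x := by
        rw [hρ]
        simp only
        rw [← mul_assoc, ← Real.exp_add]
        simp
      have e2 : Real.exp (-(σ * x)) * ρ (x - a) = Real.exp (-(σ * a)) * χ (x - a) := by
        rw [hρ]
        simp only
        rw [← mul_assoc, ← Real.exp_add]
        congr 2
        ring
      linear_combination e1 - e2
    simp only [heq] at hη
    have i1 := L2R.integrable_mul z hχ.continuous hc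
    have i2 := L2R.integrable_mul z hχm.continuous hcm
    have : ⟪z, L2R.ofTest χ hχ.continuous hc⟫ =
        Real.exp (-(σ * a)) * ⟪z, L2R.ofTest _ hχm.continuous hcm⟫ := by
      rw [L2R.inner_ofTest, L2R.inner_ofTest, ← sub_eq_zero, ← integral_const_mul,
        ← integral_sub i1 (i2.const_mul _), ← hη]
      refine integral_congr_ae (Eventually.of_forall fun x => ?_)
      ring
    rw [this, abs_mul, abs_of_pos (Real.exp_pos _)]
    gcongr
    refine (abs_real_inner_le_norm _ _).trans_eq ?_
    rw [L2R.norm_ofTest_translate hχ.continuous hc]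
  -- The shift a = σn makes the exponent -σ²n, so the factor decays for either sign of σ.
  have hlim : Tendsto (fun n : ℕ => Real.exp (-(σ * (σ * n))) *
      (‖z‖ * ‖L2R.ofTest χ hχ.continuous hc‖)) atTop (𝓝 0) := by
    rw [← zero_mul (‖z‖ * ‖L2R.ofTest χ hχ.continuous hc‖)]
    refine Tendsto.mul_const _ ?_
    refine Real.tendsto_exp_neg_atTop_nhds_zero.comp ?_
    have : (fun n : ℕ => σ * (σ * (n : ℝ))) = fun n : ℕ => (σ * σ) * (n : ℝ) := by
      funext n; ring
    rw [this]
    exact tendsto_natCast_atTop_atTop.const_mul_atTop (mul_self_pos.2 hσ)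
  exact abs_nonpos_iff.1 (ge_of_tendsto' hlim fun n => key _)

/-! ### Sobolev spaces as Hilbert spaces -/

theorem isClosed_isWeakDeriv : IsClosed {p : L2R × L2R | IsWeakDeriv p.1 p.2} := by
  simp only [isWeakDeriv_iff, ofPred_forall]
  refine isClosed_iInter fun η => isClosed_iInter fun hη => isClosed_iInter fun hc => ?_
  exact isClosed_eq (by fun_prop) (by fun_prop)

theorem Sobolev.isClosed (s : ℕ) : IsClosed (Sobolev s : Set (PiLp 2 fun _ : Fin (s + 1) => L2R)) := by
  have : (Sobolev s : Set (PiLp 2 fun _ : Fin (s + 1) => L2R)) =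
      ⋂ i : Fin s, (fun f : PiLp 2 fun _ : Fin (s + 1) => L2R => (f i.castSucc, f i.succ)) ⁻¹'
        {p : L2R × L2R | IsWeakDeriv p.1 p.2} := by
    ext f
    simp only [mem_iInter]
    exact Iff.rfl
  rw [this]
  exact isClosed_iInter fun i => isClosed_isWeakDeriv.preimage (by fun_prop)

instance (s : ℕ) : CompleteSpace (Sobolev s) :=
  (Sobolev.isClosed s).completeSpace_coe

/-- The `i`-th weak derivative as a continuous linear map `H^s(ℝ) → L²(ℝ)`. -/
noncomputable def Sobolev.comp (s : ℕ) (i : Fin (s + 1)) : Sobolev s →L[ℝ] L2R :=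
  (PiLp.proj 2 (fun _ : Fin (s + 1) => L2R) i).comp (Sobolev s).subtypeL

theorem Sobolev.fn_eq_comp {s : ℕ} (f : Sobolev s) : Sobolev.fn f = Sobolev.comp s 0 f := rfl

theorem Sobolev.isWeakDeriv_comp {s : ℕ} (f : Sobolev s) (i : Fin s) :
    IsWeakDeriv (Sobolev.comp s i.castSucc f) (Sobolev.comp s i.succ f) := f.2 i

theorem Sobolev.inner_eq {s : ℕ} (f g : Sobolev s) :
    ⟪f, g⟫ = ∑ i, ⟪Sobolev.comp s i f, Sobolev.comp s i g⟫ := rfl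

theorem Sobolev.inner_one (f g : Sobolev 1) : ⟪f, g⟫ =
    ⟪Sobolev.comp 1 0 f, Sobolev.comp 1 0 g⟫ + ⟪Sobolev.comp 1 1 f, Sobolev.comp 1 1 g⟫ := by
  rw [Sobolev.inner_eq, Fin.sum_univ_two]

theorem Sobolev.norm_sq_eq {s : ℕ} (f : Sobolev s) : ‖f‖ ^ 2 = ∑ i, ‖Sobolev.comp s i f‖ ^ 2 := by
  rw [← real_inner_self_eq_norm_sq, Sobolev.inner_eq]
  simp

theorem Sobolev.norm_sq_one (f : Sobolev 1) :
    ‖f‖ ^ 2 = ‖Sobolev.comp 1 0 f‖ ^ 2 + ‖Sobolev.comp 1 1 f‖ ^ 2 := by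
  rw [Sobolev.norm_sq_eq, Fin.sum_univ_two]

theorem Sobolev.norm_sq_two (f : Sobolev 2) :
    ‖f‖ ^ 2 = ‖Sobolev.comp 2 0 f‖ ^ 2 + ‖Sobolev.comp 2 1 f‖ ^ 2 + ‖Sobolev.comp 2 2 f‖ ^ 2 := by
  rw [Sobolev.norm_sq_eq, Fin.sum_univ_three]

theorem Sobolev.norm_comp_le {s : ℕ} (i : Fin (s + 1)) (f : Sobolev s) :
    ‖Sobolev.comp s i f‖ ≤ ‖f‖ := PiLp.norm_apply_le f.1 i

theorem Sobolev.ext_comp {s : ℕ} {f g : Sobolev s}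
    (h : ∀ i, Sobolev.comp s i f = Sobolev.comp s i g) : f = g :=
  Subtype.ext (PiLp.ext h)

/-- Uniqueness of weak derivatives propagates along the tuple. Identities in L² can therefore be
lifted to H¹ and H². -/
theorem Sobolev.fn_injective (s : ℕ) : Function.Injective (Sobolev.fn (s := s)) := by
  intro f g h
  refine Sobolev.ext_comp fun i => ?_
  induction i using Fin.induction with
  | zero => exact h
  | succ i ih => exact (Sobolev.isWeakDeriv_comp f i).unique (ih ▸ Sobolev.isWeakDeriv_comp g i)

/-- The element of `H¹(ℝ)` given by a function and its weak derivative. -/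
noncomputable def Sobolev.mk₁ (f g : L2R) (h : IsWeakDeriv f g) : Sobolev 1 :=
  ⟨WithLp.toLp 2 ![f, g], fun i => by fin_cases i; exact h⟩

/-- The element of `H²(ℝ)` given by a function and its weak derivatives. -/
noncomputable def Sobolev.mk₂ (f g k : L2R) (h : IsWeakDeriv f g) (h' : IsWeakDeriv g k) :
    Sobolev 2 :=
  ⟨WithLp.toLp 2 ![f, g, k], fun i => by
    fin_cases i
    · exact h
    · exact h'⟩

/-- The inclusion `H²(ℝ) ⊆ H¹(ℝ)`. -/
noncomputable def Sobolev.incl : Sobolev 2 →L[ℝ] Sobolev 1 :=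
  LinearMap.mkContinuous
    { toFun := fun f => Sobolev.mk₁ (Sobolev.comp 2 0 f) (Sobolev.comp 2 1 f) (f.2 0)
      map_add' := fun f g => by
        refine Sobolev.ext_comp fun i => ?_
        fin_cases i <;> rfl
      map_smul' := fun r f => by
        refine Sobolev.ext_comp fun i => ?_
        fin_cases i <;> rfl } 1 (fun f => by
      rw [one_mul]
      refine (sq_le_sq₀ (norm_nonneg _) (norm_nonneg _)).1 ?_
      rw [Sobolev.norm_sq_one, Sobolev.norm_sq_two]
      exact le_add_of_nonneg_right (sq_nonneg _))

theorem Sobolev.comp_zero_incl (f : Sobolev 2) :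
    Sobolev.comp 1 0 (Sobolev.incl f) = Sobolev.comp 2 0 f := rfl

theorem Sobolev.comp_one_incl (f : Sobolev 2) :
    Sobolev.comp 1 1 (Sobolev.incl f) = Sobolev.comp 2 1 f := rfl

theorem Sobolev.norm_dx_sq (f : Sobolev 2) :
    ‖Sobolev.dx f‖ ^ 2 = ‖Sobolev.comp 2 1 f‖ ^ 2 + ‖Sobolev.comp 2 2 f‖ ^ 2 := by
  rw [Sobolev.norm_sq_one]
  rfl

/-! ### Integration by parts in `H¹(ℝ)` -/

/-- A test function as an element of `H¹(ℝ)`. -/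
noncomputable def Sobolev.ofTest (η : ℝ → ℝ) (hη : ContDiff ℝ ∞ η) (hc : HasCompactSupport η) :
    Sobolev 1 :=
  Sobolev.mk₁ _ _ (isWeakDeriv_ofTest hη hc)

theorem L2R.eq_zero_of_isWeakDeriv_smul_self {z : L2R} {σ : ℝ} (hσ : σ ≠ 0)
    (h : IsWeakDeriv z (σ • z)) : z = 0 := by
  refine L2R.eq_zero_of_forall_integral_deriv_add z σ hσ fun η hη hc => ?_
  have h1 := isWeakDeriv_iff.1 h η hη hc
  rw [real_inner_smul_left, L2R.inner_ofTest, L2R.inner_ofTest] at h1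
  have e : ∀ x, z x * (deriv η x + σ * η x) = z x * deriv η x + σ * (z x * η x) := fun x => by ring
  simp only [e]
  rw [integral_add (L2R.integrable_mul z (hη.continuous_deriv (by simp)) hc.deriv)
    ((L2R.integrable_mul z hη.continuous hc).const_mul σ), integral_const_mul, h1]
  ring

/-- Test functions are dense in H¹: orthogonality to them means f' = g and g' = f for the two
entries of v, so f + g and f - g solve z' = z and z' = -z, and neither equation has a nonzero
solution in L². This takes the place of truncation and mollification. -/
theorem Sobolev.eq_zero_of_forall_inner_ofTest (v : Sobolev 1)
    (h : ∀ (η : ℝ → ℝ) (hη : ContDiff ℝ ∞ η) (hc : HasCompactSupport η),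
      ⟪v, Sobolev.ofTest η hη hc⟫ = 0) : v = 0 := by
  set f := Sobolev.comp 1 0 v
  set g := Sobolev.comp 1 1 v
  have h0 : IsWeakDeriv f g := v.2 0
  have h1 : IsWeakDeriv g f := by
    rw [isWeakDeriv_iff]
    intro η hη hc
    have := h η hη hc
    rw [Sobolev.inner_one] at this
    exact eq_neg_of_add_eq_zero_right this
  have hp : f + g = 0 := L2R.eq_zero_of_isWeakDeriv_smul_self (σ := 1) one_ne_zero (by
    rw [one_smul, add_comm f g]
    nth_rewrite 1 [add_comm g f]
    exact h0.add h1)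
  have hm : f + (-1 : ℝ) • g = 0 :=
    L2R.eq_zero_of_isWeakDeriv_smul_self (σ := -1) (by norm_num) (by
      rw [smul_add, smul_smul, add_comm ((-1 : ℝ) • f)]
      norm_num only [one_smul]
      exact h0.add (h1.smul (-1 : ℝ)))
  have hf : f = 0 := by
    have : (2 : ℝ) • f = 0 := by
      have := congrArg₂ (· + ·) hp hm
      simp only [neg_smul, one_smul] at this
      rw [two_smul]
      calc f + f = f + g + (f + -g) := by abel
        _ = 0 := by rw [this, add_zero]
    exact (smul_eq_zero.1 this).resolve_left two_ne_zero
  have hg : g = 0 := by simpa [hf] using hp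
  refine Sobolev.ext_comp fun i => ?_
  fin_cases i
  · simpa using hf
  · simpa using hg

/-- The functional v ↦ ⟪f, ∂ₓv⟫ + ⟪g, v⟫ is continuous on H¹ and vanishes on test functions, so its
Riesz representative is zero. -/
theorem Sobolev.inner_isWeakDeriv {f g : L2R} (h : IsWeakDeriv f g) (v : Sobolev 1) :
    ⟪f, Sobolev.comp 1 1 v⟫ = -⟪g, Sobolev.comp 1 0 v⟫ := by
  set ℓ : Sobolev 1 →L[ℝ] ℝ :=
    (innerSL ℝ f).comp (Sobolev.comp 1 1) + (innerSL ℝ g).comp (Sobolev.comp 1 0) with hℓ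
  have hz : (InnerProductSpace.toDual ℝ (Sobolev 1)).symm ℓ = 0 := by
    refine Sobolev.eq_zero_of_forall_inner_ofTest _ fun η hη hc => ?_
    rw [InnerProductSpace.toDual_symm_apply, hℓ]
    have := isWeakDeriv_iff.1 h η hη hc
    change ⟪f, _⟫ + ⟪g, _⟫ = 0
    exact add_eq_zero_iff_eq_neg.2 this
  have h0 : ℓ v = 0 := by
    rw [← InnerProductSpace.toDual_symm_apply, hz, inner_zero_left]
  exact add_eq_zero_iff_eq_neg.1 h0

theorem Sobolev.inner_comp_one_comp_one (f : Sobolev 2) (v : Sobolev 1) :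
    ⟪Sobolev.comp 2 1 f, Sobolev.comp 1 1 v⟫ = -⟪Sobolev.comp 2 2 f, Sobolev.comp 1 0 v⟫ :=
  Sobolev.inner_isWeakDeriv (f.2 1) v

theorem Sobolev.norm_comp_one_sq (f : Sobolev 2) :
    ‖Sobolev.comp 2 1 f‖ ^ 2 = -⟪Sobolev.comp 2 2 f, Sobolev.comp 2 0 f⟫ := by
  rw [← real_inner_self_eq_norm_sq]
  exact Sobolev.inner_comp_one_comp_one f (Sobolev.incl f)

/-! ### The resolvent `(1 - ∂ₓ²)⁻¹` -/

/-- The operator `(1 - ∂ₓ²)⁻¹ : L²(ℝ) → H¹(ℝ)`, as the adjoint of the inclusion. -/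
noncomputable def resolventOne : L2R →L[ℝ] Sobolev 1 :=
  ContinuousLinearMap.adjoint (Sobolev.comp 1 0)

theorem inner_resolventOne (k : L2R) (v : Sobolev 1) :
    ⟪v, resolventOne k⟫ = ⟪Sobolev.comp 1 0 v, k⟫ :=
  ContinuousLinearMap.adjoint_inner_right _ _ _

/-- Testing the adjoint relation ⟪v, Rk⟫ in H¹ = ⟪v, k⟫ in L² with test functions v gives the weak
form of Rk - ∂ₓ²Rk = k. In particular Rk lies in H². -/
theorem isWeakDeriv_resolventOne (k : L2R) :
    IsWeakDeriv (Sobolev.comp 1 1 (resolventOne k)) (Sobolev.comp 1 0 (resolventOne k) - k) := by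
  rw [isWeakDeriv_iff]
  intro η hη hc
  have h := inner_resolventOne k (Sobolev.ofTest η hη hc)
  rw [real_inner_comm, Sobolev.inner_one, real_inner_comm k] at h
  rw [inner_sub_left]
  change ⟪_, L2R.ofTest η hη.continuous hc⟫ +
    ⟪_, L2R.ofTest (deriv η) (hη.continuous_deriv (by simp)) hc.deriv⟫ =
      ⟪k, L2R.ofTest η hη.continuous hc⟫ at h
  linarith

/-- The operator `(1 - ∂ₓ²)⁻¹ : L²(ℝ) → H²(ℝ)`. -/
noncomputable def resolventTwo (k : L2R) : Sobolev 2 :=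
  Sobolev.mk₂ _ _ _ ((resolventOne k).2 0) (isWeakDeriv_resolventOne k)

/-- The operator `(1 - ∂ₓ²)⁻¹` on `L²(ℝ)`. -/
noncomputable def resolvent₀ : L2R →L[ℝ] L2R := (Sobolev.comp 1 0).comp resolventOne

theorem incl_resolventTwo (k : L2R) : Sobolev.incl (resolventTwo k) = resolventOne k := by
  refine Sobolev.ext_comp fun i => ?_
  fin_cases i <;> rfl

theorem comp_zero_resolventTwo (k : L2R) :
    Sobolev.comp 2 0 (resolventTwo k) = resolvent₀ k := rfl

theorem comp_two_resolventTwo (k : L2R) :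
    Sobolev.comp 2 2 (resolventTwo k) = resolvent₀ k - k := rfl

theorem inner_resolvent₀_left (k l : L2R) : ⟪resolvent₀ k, l⟫ = ⟪k, resolvent₀ l⟫ := by
  have h1 := inner_resolventOne l (resolventOne k)
  have h2 := inner_resolventOne k (resolventOne l)
  rw [real_inner_comm, h2] at h1
  exact h1.symm.trans (real_inner_comm _ _)

theorem inner_resolvent₀_self_nonneg (k : L2R) : 0 ≤ ⟪k, resolvent₀ k⟫ := by
  rw [real_inner_comm]
  have := inner_resolventOne k (resolventOne k)
  exact this ▸ real_inner_self_nonneg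

theorem resolvent₀_injective {k : L2R} (h : resolvent₀ k = 0) : k = 0 := by
  have h0 : resolventOne k = 0 := Sobolev.fn_injective 1 (h.trans (map_zero (Sobolev.comp 1 0)).symm)
  have h1 := isWeakDeriv_resolventOne k
  rw [h0] at h1
  simp only [map_zero, zero_sub] at h1
  simpa using h1.unique IsWeakDeriv.zero

/-! ### Integration by parts for absolutely continuous Hilbert-space valued functions -/

/-- Allows absolute continuity of an inner product to be deduced from that of its two bounded
factors. -/
theorem AbsolutelyContinuousOnInterval.of_dist_le_add {X Y Z : Type*} [PseudoMetricSpace X]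
    [PseudoMetricSpace Y] [PseudoMetricSpace Z] {f : ℝ → X} {g : ℝ → Y} {k : ℝ → Z} {a b : ℝ}
    (hg : AbsolutelyContinuousOnInterval g a b) (hk : AbsolutelyContinuousOnInterval k a b)
    (h : ∀ s ∈ uIcc a b, ∀ t ∈ uIcc a b,
      dist (f s) (f t) ≤ dist (g s) (g t) + dist (k s) (k t)) :
    AbsolutelyContinuousOnInterval f a b := by
  rw [absolutelyContinuousOnInterval_iff] at *
  intro ε hε
  obtain ⟨δ, hδ, H⟩ := hg (ε / 2) (half_pos hε)
  obtain ⟨δ', hδ', H'⟩ := hk (ε / 2) (half_pos hε)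
  refine ⟨min δ δ', lt_min hδ hδ', fun E hE hlt => ?_⟩
  have h1 := H E hE (hlt.trans_le (min_le_left _ _))
  have h2 := H' E hE (hlt.trans_le (min_le_right _ _))
  have h3 : ∑ i ∈ Finset.range E.1, dist (f (E.2 i).1) (f (E.2 i).2) ≤
      ∑ i ∈ Finset.range E.1, (dist (g (E.2 i).1) (g (E.2 i).2) +
        dist (k (E.2 i).1) (k (E.2 i).2)) := by
    refine Finset.sum_le_sum fun i hi => ?_
    have := hE.1 i hi
    exact h _ this.1 _ this.2
  rw [Finset.sum_add_distrib] at h3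
  linarith

section

variable {E : Type*} [NormedAddCommGroup E] [NormedSpace ℝ E]

theorem IntervalIntegrable.absolutelyContinuousOnInterval_primitive {f f' : ℝ → E} {a b : ℝ}
    (hab : a ≤ b) (hf' : IntervalIntegrable f' volume a b)
    (hf : ∀ t ∈ Icc a b, f t = f a + ∫ s in a..t, f' s) :
    AbsolutelyContinuousOnInterval f a b := by
  have hn := hf'.norm.absolutelyContinuousOnInterval_intervalIntegral (c := a) (by simp)
  have h0 : AbsolutelyContinuousOnInterval (fun _ : ℝ => (0 : ℝ)) a b :=
    (contDiff_const.contDiffOn).absolutelyContinuousOnInterval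
  refine hn.of_dist_le_add h0 fun s hs t ht => ?_
  have his : IntervalIntegrable f' volume a s :=
    hf'.mono_set (uIcc_subset_uIcc_left hs)
  have hit : IntervalIntegrable f' volume a t :=
    hf'.mono_set (uIcc_subset_uIcc_left ht)
  rw [uIcc_of_le hab] at hs ht
  rw [hf s hs, hf t ht, dist_add_left, dist_self, add_zero, dist_eq_norm, dist_eq_norm,
    intervalIntegral.integral_interval_sub_left his hit,
    intervalIntegral.integral_interval_sub_left his.norm hit.norm]
  exact intervalIntegral.norm_integral_le_abs_integral_norm

theorem IntervalIntegrable.ae_hasDerivAt_primitive [CompleteSpace E] {f f' : ℝ → E} {a b : ℝ}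
    (hab : a ≤ b) (hf' : IntervalIntegrable f' volume a b)
    (hf : ∀ t ∈ Icc a b, f t = f a + ∫ s in a..t, f' s) :
    ∀ᵐ t, t ∈ Ioo a b → HasDerivAt f (f' t) t := by
  filter_upwards [hf'.ae_hasDerivAt_integral] with t ht htt
  have h1 := (ht (by rw [uIcc_of_le hab]; exact Ioo_subset_Icc_self htt) a (by simp)).const_add (f a)
  refine h1.congr_of_eventuallyEq ?_
  filter_upwards [Ioo_mem_nhds htt.1 htt.2] with s hs
  exact hf s (Ioo_subset_Icc_self hs)

end

/-- The product rule, integrated, for absolutely continuous functions with values in a Hilbert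
space. -/
theorem integral_inner_add_inner_eq_sub {F : Type*} [NormedAddCommGroup F] [InnerProductSpace ℝ F]
    [CompleteSpace F] {f f' g g' : ℝ → F} {a b : ℝ} (hab : a ≤ b)
    (hf' : IntervalIntegrable f' volume a b) (hf : ∀ t ∈ Icc a b, f t = f a + ∫ s in a..t, f' s)
    (hg' : IntervalIntegrable g' volume a b) (hg : ∀ t ∈ Icc a b, g t = g a + ∫ s in a..t, g' s) :
    ∫ t in a..b, (⟪f t, g' t⟫ + ⟪f' t, g t⟫) = ⟪f b, g b⟫ - ⟪f a, g a⟫ := by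
  have hfa := hf'.absolutelyContinuousOnInterval_primitive hab hf
  have hga := hg'.absolutelyContinuousOnInterval_primitive hab hg
  obtain ⟨C, hC⟩ := hfa.exists_bound
  obtain ⟨D, hD⟩ := hga.exists_bound
  have hp : AbsolutelyContinuousOnInterval (fun t => ⟪f t, g t⟫) a b := by
    -- The oscillation of the product is at most |D| times that of f plus |C| times that of g, where
    -- C and D bound f and g.
    refine (hfa.const_smul D).of_dist_le_add (hga.const_smul C) fun s hs t ht => ?_
    have e : ⟪f s, g s⟫ - ⟪f t, g t⟫ = ⟪f s - f t, g s⟫ + ⟪f t, g s - g t⟫ := by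
      rw [inner_sub_left, inner_sub_right]; ring
    rw [dist_smul₀, dist_smul₀, Real.dist_eq, e]
    refine (abs_add_le _ _).trans (add_le_add ?_ ?_)
    · refine (abs_real_inner_le_norm _ _).trans ?_
      rw [mul_comm, dist_eq_norm]
      gcongr
      exact (hD s hs).trans (le_abs_self D)
    · refine (abs_real_inner_le_norm _ _).trans ?_
      rw [dist_eq_norm]
      gcongr
      exact (hC t ht).trans (le_abs_self C)
  rw [← hp.integral_deriv_eq_sub]
  refine intervalIntegral.integral_congr_ae ?_
  have hb : ∀ᵐ t : ℝ, t ≠ b := by simp [ae_iff, measure_singleton]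
  filter_upwards [hf'.ae_hasDerivAt_primitive hab hf, hg'.ae_hasDerivAt_primitive hab hg, hb]
    with t h1 h2 h3 ht
  rw [uIoc_of_le hab] at ht
  have ht' : t ∈ Ioo a b := ⟨ht.1, lt_of_le_of_ne ht.2 h3⟩
  exact ((h1 ht').inner ℝ (h2 ht')).deriv.symm

/-! ### Multiplication by the indicator of a half-line -/

/-- Multiplication by `1_{(-∞, r]}` on `L²(ℝ)`. -/
noncomputable def cutoff (r : ℝ) : L2R →L[ℝ] L2R :=
  LinearMap.mkContinuous
    { toFun := fun f => ((Lp.memLp f).indicator (measurableSet_Iic (a := r))).toLp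
      map_add' := fun f g => by
        apply Lp.ext
        filter_upwards [((Lp.memLp (f + g)).indicator (measurableSet_Iic (a := r))).coeFn_toLp,
          ((Lp.memLp f).indicator (measurableSet_Iic (a := r))).coeFn_toLp,
          ((Lp.memLp g).indicator (measurableSet_Iic (a := r))).coeFn_toLp, Lp.coeFn_add f g,
          Lp.coeFn_add ((Lp.memLp f).indicator (measurableSet_Iic (a := r))).toLp
            ((Lp.memLp g).indicator (measurableSet_Iic (a := r))).toLp] with x h1 h2 h3 h4 h5
        rw [h1, h5, Pi.add_apply, h2, h3]
        by_cases hx : x ∈ Iic r <;> simp only [indicator_of_mem, indicator_of_notMem, hx, h4,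
          Pi.add_apply, add_zero, not_false_eq_true]
      map_smul' := fun a f => by
        apply Lp.ext
        filter_upwards [((Lp.memLp (a • f)).indicator (measurableSet_Iic (a := r))).coeFn_toLp,
          ((Lp.memLp f).indicator (measurableSet_Iic (a := r))).coeFn_toLp, Lp.coeFn_smul a f,
          Lp.coeFn_smul a ((Lp.memLp f).indicator (measurableSet_Iic (a := r))).toLp]
          with x h1 h2 h3 h4
        simp only [RingHom.id_apply]
        rw [h1, h4, Pi.smul_apply, h2]
        by_cases hx : x ∈ Iic r <;> simp [hx, h3] } 1 (fun f => by
      rw [one_mul]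
      refine Lp.norm_le_norm_of_ae_le ?_
      filter_upwards [((Lp.memLp f).indicator (measurableSet_Iic (a := r))).coeFn_toLp] with x hx
      simp only [LinearMap.coe_mk, AddHom.coe_mk, hx]
      exact norm_indicator_le_norm_self _ _)

theorem coeFn_cutoff (r : ℝ) (f : L2R) : cutoff r f =ᵐ[volume] (Iic r).indicator f :=
  ((Lp.memLp f).indicator (measurableSet_Iic (a := r))).coeFn_toLp

theorem norm_cutoff_le (r : ℝ) (f : L2R) : ‖cutoff r f‖ ≤ ‖f‖ := by
  refine Lp.norm_le_norm_of_ae_le ?_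
  filter_upwards [coeFn_cutoff r f] with x hx
  rw [hx]
  exact norm_indicator_le_norm_self _ _

theorem inner_cutoff_cutoff (r s : ℝ) (f : L2R) :
    ⟪cutoff r f, cutoff s f⟫ = ∫ x in Iic (min r s), f x * f x := by
  rw [L2R.inner_eq_integral, ← integral_indicator measurableSet_Iic]
  refine integral_congr_ae ?_
  filter_upwards [coeFn_cutoff r f, coeFn_cutoff s f] with x h1 h2
  rw [h1, h2, ← Iic_inter_Iic, inter_comm, ← indicator_indicator]
  by_cases hr : x ∈ Iic r <;> by_cases hs : x ∈ Iic s <;> simp [hr, hs]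

/-- An indicator equals its own square. The identity provides the exact cancellation in the H¹
energy estimate and the sign of the potential in the uniqueness proof. -/
theorem inner_cutoff_self (r : ℝ) (f : L2R) : ⟪f, cutoff r f⟫ = ‖cutoff r f‖ ^ 2 := by
  rw [← real_inner_self_eq_norm_sq, inner_cutoff_cutoff, min_self, L2R.inner_eq_integral,
    ← integral_indicator measurableSet_Iic]
  refine integral_congr_ae ?_
  filter_upwards [coeFn_cutoff r f] with x h1
  rw [h1]
  by_cases hr : x ∈ Iic r <;> simp [hr]

/-- The squared distance between two cutoffs is the mass of f² between the two thresholds, which is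
controlled by the continuous primitive m. -/
theorem continuous_cutoff_apply (f : L2R) : Continuous fun r => cutoff r f := by
  have hi : Integrable fun x => f x * f x := (Lp.memLp f).integrable_mul (Lp.memLp f)
  set m : ℝ → ℝ := fun r => ∫ x in Iic r, f x * f x with hm
  have hmc : Continuous m := by
    have : m = fun r => m 0 + ∫ x in (0 : ℝ)..r, f x * f x := by
      funext r
      rw [← intervalIntegral.integral_Iic_sub_Iic hi.integrableOn hi.integrableOn]
      simp [hm]
    rw [this]
    exact continuous_const.add
      (intervalIntegral.continuous_primitive (fun _ _ => hi.intervalIntegrable) 0)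
  rw [continuous_iff_continuousAt]
  intro r
  have key : ∀ s, ‖cutoff s f - cutoff r f‖ ^ 2 = m s + m r - 2 * m (min s r) := by
    intro s
    have h1 : ‖cutoff s f‖ ^ 2 = m s := by
      rw [← real_inner_self_eq_norm_sq, inner_cutoff_cutoff, min_self]
    have h2 : ‖cutoff r f‖ ^ 2 = m r := by
      rw [← real_inner_self_eq_norm_sq, inner_cutoff_cutoff, min_self]
    rw [norm_sub_sq_real, inner_cutoff_cutoff, h1, h2]
    ring
  rw [ContinuousAt, tendsto_iff_norm_sub_tendsto_zero]
  have hsq : Tendsto (fun s => ‖cutoff s f - cutoff r f‖ ^ 2) (𝓝 r) (𝓝 0) := by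
    simp only [key]
    have : Continuous fun s => m s + m r - 2 * m (min s r) := by fun_prop
    convert this.tendsto r using 2
    rw [min_self]
    ring
  have := (Real.continuous_sqrt.tendsto 0).comp hsq
  simpa [Function.comp_def, Real.sqrt_sq] using this

/-- Each cutoff is 1-Lipschitz and the dependence on the threshold is continuous. Joint continuity
is what makes t ↦ ψ(t)f(t) strongly measurable in L² when c is merely measurable. -/
theorem continuous_cutoff : Continuous fun p : ℝ × L2R => cutoff p.1 p.2 := by
  refine continuous_prod_of_continuous_lipschitzWith' _ 1 (fun r => ?_) continuous_cutoff_apply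
  refine LipschitzWith.of_dist_le_mul fun f g => ?_
  rw [dist_eq_norm, dist_eq_norm, NNReal.coe_one, one_mul, ← map_sub]
  exact norm_cutoff_le r _

theorem MeasureTheory.AEStronglyMeasurable.cutoff {μ : Measure ℝ} {c : ℝ → ℝ} {f : ℝ → L2R}
    (hf : AEStronglyMeasurable f μ) (hc : AEMeasurable c μ) :
    AEStronglyMeasurable (fun t => _root_.cutoff (c t) (f t)) μ :=
  continuous_cutoff.comp_aestronglyMeasurable (hc.aestronglyMeasurable.prodMk hf)

theorem MeasureTheory.MemLp.cutoff {μ : Measure ℝ} {c : ℝ → ℝ} {f : ℝ → L2R}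
    (hf : MemLp f 2 μ) (hc : AEMeasurable c μ) : MemLp (fun t => _root_.cutoff (c t) (f t)) 2 μ :=
  hf.mono (hf.aestronglyMeasurable.cutoff hc) (Eventually.of_forall fun _ => norm_cutoff_le _ _)

theorem inner_cutoff_ofTest (c : ℝ → ℝ) (t : ℝ) (f : L2R) {η : ℝ → ℝ} (hη : Continuous η)
    (hc : HasCompactSupport η) :
    ⟪cutoff (c t) f, L2R.ofTest η hη hc⟫ = ∫ x, killing c t x * f x * η x := by
  rw [L2R.inner_ofTest]
  refine integral_congr_ae ?_
  filter_upwards [coeFn_cutoff (c t) f] with x hx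
  rw [hx, killing]
  by_cases h : x ∈ Iic (c t) <;> simp [h]

/-! ### Smooth trajectories and their data -/

/-- Lebesgue measure on the time axis `[0, ∞)`. -/
noncomputable abbrev halfLine : Measure ℝ := volume.restrict (Ici (0 : ℝ))

theorem MeasureTheory.Lp.norm_sq_eq_integral {α E : Type*} [MeasurableSpace α] {μ : Measure α}
    [NormedAddCommGroup E] [InnerProductSpace ℝ E] (f : Lp E 2 μ) :
    ‖f‖ ^ 2 = ∫ t, ‖f t‖ ^ 2 ∂μ := by
  rw [← real_inner_self_eq_norm_sq, MeasureTheory.L2.inner_def]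
  simp

theorem MeasureTheory.MemLp.norm_sq_toLp {α E : Type*} [MeasurableSpace α] {μ : Measure α}
    [NormedAddCommGroup E] [InnerProductSpace ℝ E] {f : α → E} (hf : MemLp f 2 μ) :
    ‖hf.toLp‖ ^ 2 = ∫ t, ‖f t‖ ^ 2 ∂μ := by
  rw [MeasureTheory.Lp.norm_sq_eq_integral]
  refine integral_congr_ae ?_
  filter_upwards [hf.coeFn_toLp] with t ht
  rw [ht]

theorem Continuous.memLp_halfLine {E : Type*} [NormedAddCommGroup E] {f : ℝ → E}
    (hf : Continuous f) {R : ℝ} (hR : ∀ t, R ≤ t → f t = 0) : MemLp f 2 halfLine := by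
  obtain ⟨C, hC⟩ := isCompact_Icc.exists_bound_of_continuousOn (s := Icc 0 R) hf.continuousOn
  have h1 : MemLp ((Icc 0 R).indicator f) 2 halfLine := by
    rw [memLp_indicator_iff_restrict measurableSet_Icc, Measure.restrict_restrict measurableSet_Icc]
    have : IsFiniteMeasure (volume.restrict (Icc 0 R ∩ Ici (0 : ℝ))) :=
      ⟨by
        rw [Measure.restrict_apply_univ]
        exact (measure_mono inter_subset_left).trans_lt measure_Icc_lt_top⟩
    refine MemLp.of_bound hf.aestronglyMeasurable C ?_
    filter_upwards [ae_restrict_mem (measurableSet_Icc.inter measurableSet_Ici)] with t ht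
    exact hC t ht.1
  refine h1.ae_eq ?_
  filter_upwards [ae_restrict_mem measurableSet_Ici] with t ht
  by_cases h : t ≤ R
  · exact indicator_of_mem (show t ∈ Icc 0 R from ⟨ht, h⟩) f
  · rw [indicator_of_notMem (fun h' => h h'.2), hR t (not_le.1 h).le]

/-- Continuously differentiable functions of time with values in `H²(ℝ)` that vanish for large
times. -/
def Trajectory : Submodule ℝ (ℝ → Sobolev 2) where
  carrier := {V | ContDiff ℝ 1 V ∧ ∃ R, ∀ t, R ≤ t → V t = 0}
  zero_mem' := ⟨contDiff_const, 0, fun _ _ => rfl⟩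
  add_mem' := by
    rintro V W ⟨hV, R, hR⟩ ⟨hW, S, hS⟩
    refine ⟨hV.add hW, max R S, fun t ht => ?_⟩
    rw [Pi.add_apply, hR t ((le_max_left _ _).trans ht), hS t ((le_max_right _ _).trans ht),
      add_zero]
  smul_mem' := by
    rintro r V ⟨hV, R, hR⟩
    exact ⟨hV.const_smul r, R, fun t ht => by rw [Pi.smul_apply, hR t ht, smul_zero]⟩

theorem Trajectory.hasDerivAt (V : Trajectory) (t : ℝ) : HasDerivAt V.1 (deriv V.1 t) t :=
  (V.2.1.differentiable (by simp) t).hasDerivAt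

theorem Trajectory.continuous_deriv (V : Trajectory) : Continuous (deriv V.1) :=
  V.2.1.continuous_deriv le_rfl

theorem Trajectory.exists_eq_zero (V : Trajectory) :
    ∃ R, ∀ t, R ≤ t → V.1 t = 0 ∧ deriv V.1 t = 0 := by
  obtain ⟨R, hR⟩ := V.2.2
  -- The margin 1 puts t in the interior of the zero set, so that the derivative vanishes there too.
  refine ⟨R + 1, fun t ht => ⟨hR t (by linarith), ?_⟩⟩
  have : V.1 =ᶠ[𝓝 t] fun _ => 0 := by
    filter_upwards [Ioi_mem_nhds (show R < t by linarith)] with s hs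
    exact hR s (le_of_lt hs)
  rw [this.deriv_eq, deriv_const]

theorem Trajectory.memLp (V : Trajectory) : MemLp V.1 2 halfLine := by
  obtain ⟨R, hR⟩ := V.2.2
  exact V.2.1.continuous.memLp_halfLine hR

theorem Trajectory.memLp_comp (V : Trajectory) (i : Fin 3) :
    MemLp (fun t => Sobolev.comp 2 i (V.1 t)) 2 halfLine := by
  obtain ⟨R, hR⟩ := V.2.2
  exact ((Sobolev.comp 2 i).continuous.comp V.2.1.continuous).memLp_halfLine
    (R := R) fun t ht => by simp [hR t ht]

/-- The right-hand side `∂ₜV - ½ ∂ₓ²V + 2V + B V`. -/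
noncomputable def Trajectory.source (B : ℝ → L2R →L[ℝ] L2R) (V : Trajectory) (t : ℝ) : L2R :=
  Sobolev.comp 2 0 (deriv V.1 t) - (1 / 2 : ℝ) • Sobolev.comp 2 2 (V.1 t)
    + (2 : ℝ) • Sobolev.comp 2 0 (V.1 t) + B t (Sobolev.comp 2 0 (V.1 t))

/-- Multiplication by the time-dependent operator `B` preserves `L²`. -/
def PreservesMemLp (B : ℝ → L2R →L[ℝ] L2R) : Prop :=
  ∀ f : ℝ → L2R, MemLp f 2 halfLine → MemLp (fun t => B t (f t)) 2 halfLine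

theorem preservesMemLp_zero : PreservesMemLp 0 := fun _ _ => MemLp.zero

theorem preservesMemLp_cutoff {c : ℝ → ℝ} (hc : AEMeasurable c halfLine) :
    PreservesMemLp fun t => cutoff (c t) := fun _ hf => hf.cutoff hc

theorem Trajectory.memLp_source {B : ℝ → L2R →L[ℝ] L2R} (hB : PreservesMemLp B)
    (V : Trajectory) : MemLp (Trajectory.source B V) 2 halfLine := by
  obtain ⟨R, hR⟩ := Trajectory.exists_eq_zero V
  have h1 : MemLp (fun t => Sobolev.comp 2 0 (deriv V.1 t)) 2 halfLine :=
    ((Sobolev.comp 2 0).continuous.comp (Trajectory.continuous_deriv V)).memLp_halfLine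
      (R := R) fun t ht => by simp [(hR t ht).2]
  have h2 : MemLp (fun t => (1 / 2 : ℝ) • Sobolev.comp 2 2 (V.1 t)) 2 halfLine :=
    (Trajectory.memLp_comp V 2).const_smul (1 / 2 : ℝ)
  have h3 : MemLp (fun t => (2 : ℝ) • Sobolev.comp 2 0 (V.1 t)) 2 halfLine :=
    (Trajectory.memLp_comp V 0).const_smul (2 : ℝ)
  have h4 := hB _ (Trajectory.memLp_comp V 0)
  have h5 : Trajectory.source B V = fun t =>
      Sobolev.comp 2 0 (deriv V.1 t) - (1 / 2 : ℝ) • Sobolev.comp 2 2 (V.1 t)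
        + (2 : ℝ) • Sobolev.comp 2 0 (V.1 t) + B t (Sobolev.comp 2 0 (V.1 t)) := rfl
  rw [h5]
  exact ((h1.sub h2).add h3).add h4

theorem Trajectory.source_add (B : ℝ → L2R →L[ℝ] L2R) (V W : Trajectory) :
    Trajectory.source B (V + W) = Trajectory.source B V + Trajectory.source B W := by
  funext t
  have h : deriv (V.1 + W.1) t = deriv V.1 t + deriv W.1 t :=
    ((Trajectory.hasDerivAt V t).add (Trajectory.hasDerivAt W t)).deriv
  simp only [Trajectory.source, h, Submodule.coe_add, Pi.add_apply, map_add, smul_add]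
  abel

theorem Trajectory.source_smul (B : ℝ → L2R →L[ℝ] L2R) (r : ℝ) (V : Trajectory) :
    Trajectory.source B (r • V) = r • Trajectory.source B V := by
  funext t
  have h : deriv (r • V.1) t = r • deriv V.1 t := ((Trajectory.hasDerivAt V t).const_smul r).deriv
  simp only [Trajectory.source, h, Submodule.coe_smul, Pi.smul_apply, map_smul, smul_add, smul_sub]
  rw [smul_comm r (1 / 2 : ℝ), smul_comm r (2 : ℝ)]

/-- The space of Cauchy data: an initial value in `H¹(ℝ)` and a right-hand side in
`L²([0,∞); L²(ℝ))`. -/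
abbrev CauchyData : Type := WithLp 2 (Sobolev 1 × Lp L2R 2 halfLine)

/-- The Cauchy data of a trajectory. -/
noncomputable def Trajectory.data {B : ℝ → L2R →L[ℝ] L2R} (hB : PreservesMemLp B) :
    Trajectory →ₗ[ℝ] CauchyData where
  toFun V := WithLp.toLp 2 (Sobolev.incl (V.1 0), (Trajectory.memLp_source hB V).toLp)
  map_add' V W := by
    rw [← WithLp.toLp_add, Prod.mk_add_mk, ← MemLp.toLp_add, Submodule.coe_add, Pi.add_apply,
      map_add]
    congr 3
    exact Trajectory.source_add B V W
  map_smul' r V := by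
    rw [RingHom.id_apply, ← WithLp.toLp_smul, Prod.smul_mk, ← MemLp.toLp_const_smul,
      Submodule.coe_smul, Pi.smul_apply, map_smul]
    congr 3
    exact Trajectory.source_smul B r V

theorem Trajectory.norm_data_sq {B : ℝ → L2R →L[ℝ] L2R} (hB : PreservesMemLp B)
    (V : Trajectory) : ‖Trajectory.data hB V‖ ^ 2 =
      ‖Sobolev.incl (V.1 0)‖ ^ 2 + ∫ t, ‖Trajectory.source B V t‖ ^ 2 ∂halfLine := by
  rw [WithLp.prod_norm_sq_eq_of_L2, ← (Trajectory.memLp_source hB V).norm_sq_toLp]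
  rfl

theorem Trajectory.inner_data {B : ℝ → L2R →L[ℝ] L2R} (hB : PreservesMemLp B)
    (V : Trajectory) (z : CauchyData) : ⟪z, Trajectory.data hB V⟫ =
      ⟪z.fst, Sobolev.incl (V.1 0)⟫ + ∫ t, ⟪z.snd t, Trajectory.source B V t⟫ ∂halfLine := by
  rw [WithLp.prod_inner_apply]
  refine congrArg (fun r => ⟪z.fst, Sobolev.incl (V.1 0)⟫ + r) ?_
  rw [MeasureTheory.L2.inner_def]
  refine integral_congr_ae ?_
  filter_upwards [(Trajectory.memLp_source hB V).coeFn_toLp] with t ht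
  exact congrArg (fun r => ⟪z.snd t, r⟫) ht

/-! ### Energy inequalities -/

theorem add_integral_le_of_deriv_le {φ φ' a b : ℝ → ℝ} (hφ : ∀ t, HasDerivAt φ (φ' t) t)
    (hφ' : Continuous φ') {t : ℝ} (ht : 0 ≤ t) (ha : IntervalIntegrable a volume 0 t)
    (hb : Integrable b halfLine) (hb0 : ∀ s, 0 ≤ b s) (h : ∀ s ∈ Icc 0 t, φ' s ≤ -a s + b s) :
    φ t + ∫ s in (0 : ℝ)..t, a s ≤ φ 0 + ∫ s, b s ∂halfLine := by
  have hsub : Ioc 0 t ⊆ Ici (0 : ℝ) := fun s hs => hs.1.le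
  have hbi : IntervalIntegrable b volume 0 t :=
    (intervalIntegrable_iff_integrableOn_Ioc_of_le ht).2 (IntegrableOn.mono_set hb hsub)
  have h1 : φ t - φ 0 = ∫ s in (0 : ℝ)..t, φ' s :=
    (intervalIntegral.integral_eq_sub_of_hasDerivAt (fun s _ => hφ s)
      (hφ'.intervalIntegrable _ _)).symm
  have h2 : ∫ s in (0 : ℝ)..t, φ' s ≤ ∫ s in (0 : ℝ)..t, (-a s + b s) :=
    intervalIntegral.integral_mono_on ht (hφ'.intervalIntegrable _ _) (ha.neg.add hbi) h
  have h4 : ∫ s in (0 : ℝ)..t, (-a s + b s) =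
      -(∫ s in (0 : ℝ)..t, a s) + ∫ s in (0 : ℝ)..t, b s := by
    rw [← intervalIntegral.integral_neg]
    exact intervalIntegral.integral_add ha.neg hbi
  have h3 : ∫ s in (0 : ℝ)..t, b s ≤ ∫ s, b s ∂halfLine := by
    rw [intervalIntegral.integral_of_le ht]
    exact setIntegral_mono_set hb (Eventually.of_forall hb0)
      (Eventually.of_forall hsub)
  linarith

/-- The estimate on [0,t] is uniform in t once φ(t) ≥ 0 is dropped, and t tends to infinity. -/
theorem integral_halfLine_le_of_deriv_le {φ φ' a b : ℝ → ℝ} (hφ : ∀ t, HasDerivAt φ (φ' t) t)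
    (hφ' : Continuous φ') (ha : Integrable a halfLine) (hb : Integrable b halfLine)
    (hb0 : ∀ t, 0 ≤ b t) (hφ0 : ∀ t, 0 ≤ φ t) (h : ∀ t, φ' t ≤ -a t + b t) :
    ∫ s, a s ∂halfLine ≤ φ 0 + ∫ s, b s ∂halfLine := by
  have hl : Tendsto (fun t => ∫ s in (0 : ℝ)..t, a s) atTop (𝓝 (∫ s, a s ∂halfLine)) := by
    rw [integral_Ici_eq_integral_Ioi]
    exact intervalIntegral_tendsto_integral_Ioi 0 (IntegrableOn.mono_set ha Ioi_subset_Ici_self)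
      tendsto_id
  refine le_of_tendsto hl ?_
  filter_upwards [eventually_ge_atTop 0] with t ht
  have hai : IntervalIntegrable a volume 0 t :=
    (intervalIntegrable_iff_integrableOn_Ioc_of_le ht).2
      (IntegrableOn.mono_set ha fun s hs => hs.1.le)
  have := add_integral_le_of_deriv_le hφ hφ' ht hai hb hb0 fun s _ => h s
  linarith [hφ0 t]

theorem Trajectory.comp_zero_deriv (B : ℝ → L2R →L[ℝ] L2R) (V : Trajectory) (t : ℝ) :
    Sobolev.comp 2 0 (deriv V.1 t) = Trajectory.source B V t + (1 / 2 : ℝ) • Sobolev.comp 2 2 (V.1 t)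
      - (2 : ℝ) • Sobolev.comp 2 0 (V.1 t) - B t (Sobolev.comp 2 0 (V.1 t)) := by
  rw [Trajectory.source]
  abel

/-- The L² energy identity for the equation without potential, with 2‖v‖‖F‖ ≤ 2‖v‖² + ½‖F‖² absorbed
in the term -4‖v‖² coming from the shift. What matters is that the constant ½ is less than 1, since
it is the contraction factor in `Trajectory.denseRange_data`. -/
theorem Trajectory.integral_norm_sq_le (V : Trajectory) :
    ∫ t, ‖Sobolev.comp 2 0 (V.1 t)‖ ^ 2 ∂halfLine ≤
      (1 / 2) * ‖Trajectory.data preservesMemLp_zero V‖ ^ 2 := by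
  set v : ℝ → L2R := fun t => Sobolev.comp 2 0 (V.1 t)
  set F := Trajectory.source 0 V
  have hd : ∀ t, HasDerivAt (fun t => ‖v t‖ ^ 2) (2 * ⟪v t, Sobolev.comp 2 0 (deriv V.1 t)⟫) t :=
    fun t => ((Sobolev.comp 2 0).hasFDerivAt.comp_hasDerivAt t (Trajectory.hasDerivAt V t)).norm_sq
  have hv : Continuous v := (Sobolev.comp 2 0).continuous.comp V.2.1.continuous
  have hc : Continuous fun t => 2 * ⟪v t, Sobolev.comp 2 0 (deriv V.1 t)⟫ :=
    continuous_const.mul (hv.inner ((Sobolev.comp 2 0).continuous.comp (Trajectory.continuous_deriv V)))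
  have h := integral_halfLine_le_of_deriv_le hd hc
    (a := fun t => 2 * ‖v t‖ ^ 2) (b := fun t => 1 / 2 * ‖F t‖ ^ 2)
    ((Trajectory.memLp_comp V 0).integrable_norm_pow (by simp) |>.const_mul 2)
    ((Trajectory.memLp_source preservesMemLp_zero V).integrable_norm_pow (by simp) |>.const_mul _)
    (fun t => by positivity) (fun t => by positivity) (fun t => by
      rw [Trajectory.comp_zero_deriv 0 V t]
      have h1 := Sobolev.norm_comp_one_sq (V.1 t)
      rw [real_inner_comm] at h1
      change _ = -⟪v t, _⟫ at h1
      have h2 := abs_le.1 (abs_real_inner_le_norm (v t) (F t))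
      simp only [Pi.zero_apply, _root_.zero_apply, sub_zero, inner_sub_right,
        inner_add_right, real_inner_smul_right]
      change 2 * (⟪v t, F t⟫ + 1 / 2 * ⟪v t, _⟫ - 2 * ⟪v t, v t⟫) ≤ _
      rw [real_inner_self_eq_norm_sq]
      nlinarith [sq_nonneg (‖v t‖ - 1 / 2 * ‖F t‖), sq_nonneg ‖Sobolev.comp 2 1 (V.1 t)‖])
  rw [integral_const_mul, integral_const_mul] at h
  rw [Trajectory.norm_data_sq]
  have h0 : ‖v 0‖ ^ 2 ≤ ‖Sobolev.incl (V.1 0)‖ ^ 2 := by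
    gcongr
    exact Sobolev.norm_comp_le 0 (Sobolev.incl (V.1 0))
  change _ ≤ 1 / 2 * (_ + ∫ t, ‖F t‖ ^ 2 ∂halfLine)
  have : 0 ≤ ∫ t, ‖F t‖ ^ 2 ∂halfLine := integral_nonneg fun t => by positivity
  nlinarith

/-! ### Density of the data of trajectories -/

/-- The operator `1/2 + 3/2 (1 - ∂ₓ²)⁻¹ = (2 - ½ ∂ₓ²) (1 - ∂ₓ²)⁻¹`. -/
noncomputable def generatorResolvent : L2R →L[ℝ] L2R :=
  (1 / 2 : ℝ) • ContinuousLinearMap.id ℝ L2R + (3 / 2 : ℝ) • resolvent₀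

theorem generatorResolvent_apply (k : L2R) :
    generatorResolvent k = (1 / 2 : ℝ) • k + (3 / 2 : ℝ) • resolvent₀ k := rfl

theorem inner_generatorResolvent_left (k l : L2R) :
    ⟪generatorResolvent k, l⟫ = ⟪k, generatorResolvent l⟫ := by
  simp only [generatorResolvent_apply, inner_add_left, inner_add_right, real_inner_smul_left,
    real_inner_smul_right, inner_resolvent₀_left]

/-- With y = Rk this is ⟪(2 - ½∂ₓ²)y, y⟫ ≥ 0, the source of the monotonicity of ‖y‖² in the density
proof. -/
theorem inner_generatorResolvent_resolvent₀_nonneg (k : L2R) :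
    0 ≤ ⟪generatorResolvent k, resolvent₀ k⟫ := by
  rw [generatorResolvent_apply, inner_add_left, real_inner_smul_left, real_inner_smul_left,
    real_inner_self_eq_norm_sq]
  have := inner_resolvent₀_self_nonneg k
  positivity

/-- The trajectory `t ↦ Θ(t) (1 - ∂ₓ²)⁻¹ k`. -/
noncomputable def Trajectory.ofScalar (Θ : ℝ → ℝ) (hΘ : ContDiff ℝ 1 Θ) {R : ℝ}
    (hR : ∀ t, R ≤ t → Θ t = 0) (k : L2R) : Trajectory :=
  ⟨fun t => Θ t • resolventTwo k, hΘ.smul contDiff_const, R, fun t ht => by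
    simp only [hR t ht, zero_smul]⟩

theorem Trajectory.source_ofScalar {Θ θ : ℝ → ℝ} (hΘ : ContDiff ℝ 1 Θ) {R : ℝ}
    (hR : ∀ t, R ≤ t → Θ t = 0) (k : L2R) (hθ : ∀ t, HasDerivAt Θ (θ t) t) (t : ℝ) :
    Trajectory.source 0 (Trajectory.ofScalar Θ hΘ hR k) t =
      θ t • resolvent₀ k + Θ t • generatorResolvent k := by
  have hd : deriv (fun t => Θ t • resolventTwo k) t = θ t • resolventTwo k :=
    ((hθ t).smul_const _).deriv
  simp only [Trajectory.source, Trajectory.ofScalar, hd, map_smul, comp_zero_resolventTwo,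
    comp_two_resolventTwo, generatorResolvent_apply, Pi.zero_apply, _root_.zero_apply]
  module

theorem exists_globalRepresentative (g : Lp L2R 2 halfLine) :
    ∃ G : ℝ → L2R, MemLp G 2 volume ∧ G =ᵐ[halfLine] g := by
  refine ⟨(Ici (0 : ℝ)).indicator g, ?_, ?_⟩
  · rw [memLp_indicator_iff_restrict measurableSet_Ici]
    exact Lp.memLp g
  · filter_upwards [ae_restrict_mem measurableSet_Ici] with t ht
    rw [indicator_of_mem ht]

theorem MeasureTheory.MemLp.locallyIntegrable_two {E : Type*} [NormedAddCommGroup E] {f : ℝ → E}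
    (hf : MemLp f 2 volume) : LocallyIntegrable f volume :=
  hf.locallyIntegrable (by norm_num)

/-- Orthogonality to the data of Θ(t)Rk says weakly in time that y = RG has derivative (2 - ½∂ₓ²)y
and initial value b, the first component of z. The resolvent is used because G itself is only square
integrable with values in L², whereas RG has two space derivatives. The equality is obtained by
testing RG - M with every scalar θ in time and every k in L². -/
theorem resolvent₀_eq_primitive {z : CauchyData}
    (hz : ∀ V, ⟪z, Trajectory.data preservesMemLp_zero V⟫ = 0) {G : ℝ → L2R}
    (hG : MemLp G 2 volume) (hGz : G =ᵐ[halfLine] z.snd) :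
    ∀ᵐ t ∂halfLine, resolvent₀ (G t) =
      Sobolev.comp 1 0 z.fst + ∫ s in (0 : ℝ)..t, generatorResolvent (G s) := by
  have hy : MemLp (fun t => resolvent₀ (G t)) 2 volume := resolvent₀.comp_memLp' hG
  have hm : MemLp (fun t => generatorResolvent (G t)) 2 volume :=
    generatorResolvent.comp_memLp' hG
  have hmi : ∀ a b, IntervalIntegrable (fun t => generatorResolvent (G t)) volume a b :=
    fun a b => (hm.locallyIntegrable_two.integrableOn_isCompact isCompact_uIcc).intervalIntegrable
  have hyi : ∀ a b, IntervalIntegrable (fun t => resolvent₀ (G t)) volume a b :=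
    fun a b => (hy.locallyIntegrable_two.integrableOn_isCompact isCompact_uIcc).intervalIntegrable
  set M : ℝ → L2R := fun t =>
    Sobolev.comp 1 0 z.fst + ∫ s in (0 : ℝ)..t, generatorResolvent (G s) with hM
  have hMc : Continuous M :=
    continuous_const.add (intervalIntegral.continuous_primitive hmi 0)
  have hM0 : M 0 = Sobolev.comp 1 0 z.fst := by simp [hM]
  -- the difference vanishes when tested with smooth functions of time
  have hloc : LocallyIntegrable (fun t => resolvent₀ (G t) - M t) volume :=
    hy.locallyIntegrable_two.sub hMc.locallyIntegrable
  have key : ∀ᵐ t, (Ici (0 : ℝ)).indicator (fun t => resolvent₀ (G t) - M t) t = 0 := by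
    refine ae_eq_zero_of_integral_contDiff_smul_eq_zero
      (hloc.indicator measurableSet_Ici) fun θ hθ hθc => ?_
    obtain ⟨R₀, hR₀⟩ := hθc.isCompact.isBounded.subset_closedBall 0
    set R : ℝ := max R₀ 0
    have hR0 : 0 ≤ R := le_max_right _ _
    have hθR : ∀ t, R < t → θ t = 0 := by
      intro t ht
      by_contra hne
      have h1 := hR₀ (subset_tsupport _ hne)
      rw [mem_closedBall_zero_iff, Real.norm_eq_abs] at h1
      linarith [le_abs_self t, le_max_left R₀ 0]
    -- Integrating from R makes Θ vanish beyond R, as a trajectory requires. Its value at 0 is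
    -- unconstrained, and this is how the initial value enters.
    set Θ : ℝ → ℝ := fun t => ∫ s in R..t, θ s with hΘdef
    have hΘd : ∀ t, HasDerivAt Θ (θ t) t :=
      fun t => (hθ.continuous.integral_hasStrictDerivAt R t).hasDerivAt
    have hΘ : ContDiff ℝ 1 Θ := by
      rw [contDiff_one_iff_deriv]
      refine ⟨fun t => (hΘd t).differentiableAt, ?_⟩
      rw [show deriv Θ = θ from funext fun t => (hΘd t).deriv]
      exact hθ.continuous
    have hΘR : ∀ t, R ≤ t → Θ t = 0 := by
      intro t ht
      rw [hΘdef]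
      refine (intervalIntegral.integral_congr_ae (g := fun _ => (0 : ℝ)) ?_).trans (by simp)
      refine Eventually.of_forall fun s hs => hθR s ?_
      rw [uIoc_of_le ht] at hs
      exact hs.1
    -- the equation tested with `Θ k`
    have htest : ∀ k : L2R, Θ 0 * ⟪Sobolev.comp 1 0 z.fst, k⟫ +
        ∫ t in (0 : ℝ)..R, (θ t * ⟪resolvent₀ (G t), k⟫ +
          Θ t * ⟪generatorResolvent (G t), k⟫) = 0 := by
      intro k
      have h1 := hz (Trajectory.ofScalar Θ hΘ hΘR k)
      rw [Trajectory.inner_data] at h1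
      have h2 : ⟪z.fst, Sobolev.incl ((Trajectory.ofScalar Θ hΘ hΘR k).1 0)⟫ =
          Θ 0 * ⟪Sobolev.comp 1 0 z.fst, k⟫ := by
        simp only [Trajectory.ofScalar, map_smul, incl_resolventTwo]
        exact (real_inner_smul_right _ _ _).trans
          (congrArg (fun r => Θ 0 * r) (inner_resolventOne k z.fst))
      rw [h2] at h1
      refine (congrArg (fun r => Θ 0 * ⟪Sobolev.comp 1 0 z.fst, k⟫ + r) ?_).trans h1
      rw [intervalIntegral.integral_of_le hR0, ← integral_Icc_eq_integral_Ioc]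
      have h3 : ∫ t, ⟪z.snd t, Trajectory.source 0 (Trajectory.ofScalar Θ hΘ hΘR k) t⟫ ∂halfLine =
          ∫ t in Ici (0 : ℝ), (θ t * ⟪resolvent₀ (G t), k⟫ +
            Θ t * ⟪generatorResolvent (G t), k⟫) := by
        refine integral_congr_ae ?_
        filter_upwards [hGz] with t ht
        rw [Trajectory.source_ofScalar hΘ hΘR k hΘd, ← ht, inner_add_right,
          real_inner_smul_right, real_inner_smul_right, inner_resolvent₀_left,
          inner_generatorResolvent_left]
      rw [h3]
      refine (setIntegral_eq_of_subset_of_forall_sdiff_eq_zero measurableSet_Ici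
        Icc_subset_Ici_self fun t ht => ?_).symm
      have htR : R < t := by
        by_contra hcon
        exact ht.2 ⟨ht.1, not_lt.1 hcon⟩
      rw [hθR t htR, hΘR t htR.le]
      ring
    -- integration by parts
    have hparts : ∀ k : L2R, ∫ t in (0 : ℝ)..R, (⟪Θ t • k, generatorResolvent (G t)⟫ +
        ⟪θ t • k, M t⟫) = -(Θ 0 * ⟪Sobolev.comp 1 0 z.fst, k⟫) := by
      intro k
      have h := integral_inner_add_inner_eq_sub (f := fun t => Θ t • k) (f' := fun t => θ t • k)
        (g := M) (g' := fun t => generatorResolvent (G t)) hR0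
        ((hθ.continuous.smul continuous_const).intervalIntegrable _ _) (fun t _ => by
          rw [intervalIntegral.integral_eq_sub_of_hasDerivAt
            (fun s _ => (hΘd s).smul_const k)
            ((hθ.continuous.smul continuous_const).intervalIntegrable _ _)]
          abel)
        (hmi 0 R) (fun t _ => by rw [hM0])
      rw [h, hΘR R le_rfl, hM0, zero_smul, inner_zero_left, real_inner_smul_left,
        real_inner_comm k]
      ring
    have hint : IntegrableOn (fun t => θ t • (resolvent₀ (G t) - M t)) (Ici 0) volume := by
      have : Integrable (fun t => θ t • (resolvent₀ (G t) - M t)) volume :=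
        hloc.integrable_smul_left_of_hasCompactSupport hθ.continuous hθc
      exact this.integrableOn
    have hzero : ∫ t in Ici (0 : ℝ), θ t • (resolvent₀ (G t) - M t) = 0 := by
      refine integral_eq_zero_of_forall_integral_inner_eq_zero ℝ _ hint fun k => ?_
      have h1 := htest k
      have h2 := hparts k
      have e : ∫ t in Ici (0 : ℝ), ⟪k, θ t • (resolvent₀ (G t) - M t)⟫ =
          ∫ t in (0 : ℝ)..R, ((θ t * ⟪resolvent₀ (G t), k⟫ +
            Θ t * ⟪generatorResolvent (G t), k⟫) - (⟪Θ t • k, generatorResolvent (G t)⟫ +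
              ⟪θ t • k, M t⟫)) := by
        rw [intervalIntegral.integral_of_le hR0, ← integral_Icc_eq_integral_Ioc]
        have hsub := setIntegral_eq_of_subset_of_forall_sdiff_eq_zero (μ := volume)
          (f := fun t => ⟪k, θ t • (resolvent₀ (G t) - M t)⟫)
          (s := Icc 0 R) measurableSet_Ici
          Icc_subset_Ici_self (fun t ht => ?_)
        · rw [hsub]
          refine integral_congr_ae (Eventually.of_forall fun t => ?_)
          simp only [real_inner_smul_left, real_inner_smul_right, inner_sub_right,
            real_inner_comm k]
          ring
        · have htR : R < t := by
            by_contra hcon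
            exact ht.2 ⟨ht.1, not_lt.1 hcon⟩
          rw [hθR t htR, zero_smul, inner_zero_right]
      rw [e, intervalIntegral.integral_sub]
      · linarith
      · have i1 : ∀ {f : ℝ → L2R}, IntervalIntegrable f volume 0 R →
            IntervalIntegrable (fun t => ⟪f t, k⟫) volume 0 R := fun hf =>
          ⟨hf.1.inner_const k, hf.2.inner_const k⟩
        exact ((i1 (hyi 0 R)).continuousOn_mul hθ.continuous.continuousOn).add
          ((i1 (hmi 0 R)).continuousOn_mul hΘ.continuous.continuousOn)
      · have i2 : IntervalIntegrable (fun t => ⟪k, generatorResolvent (G t)⟫) volume 0 R :=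
          ⟨(hmi 0 R).1.const_inner k, (hmi 0 R).2.const_inner k⟩
        have i3 : IntervalIntegrable (fun t => ⟪θ t • k, M t⟫) volume 0 R :=
          ((hθ.continuous.smul continuous_const).inner hMc).intervalIntegrable _ _
        simp only [real_inner_smul_left] at i3 ⊢
        exact (i2.continuousOn_mul hΘ.continuous.continuousOn).add i3
    rw [← hzero, ← integral_indicator measurableSet_Ici]
    refine integral_congr_ae (Eventually.of_forall fun t => ?_)
    by_cases ht : t ∈ Ici (0 : ℝ) <;> simp [ht]
  have h2 := ae_restrict_of_ae (s := Ici (0 : ℝ)) key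
  filter_upwards [h2, ae_restrict_mem measurableSet_Ici] with t ht htm
  rw [indicator_of_mem htm] at ht
  exact sub_eq_zero.1 ht

/-- The continuous version M of RG satisfies d/dt‖M‖² = 2⟪(2 - ½∂ₓ²)M, M⟫ ≥ 0 almost everywhere,
while ‖M‖² is integrable on [0,∞). Hence M = 0: its value at 0 kills the first component of z, and
injectivity of the resolvent kills the second. -/
theorem eq_zero_of_forall_inner_data {z : CauchyData}
    (hz : ∀ V, ⟪z, Trajectory.data preservesMemLp_zero V⟫ = 0) : z = 0 := by
  obtain ⟨G, hG, hGz⟩ := exists_globalRepresentative z.snd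
  have hae := resolvent₀_eq_primitive hz hG hGz
  have hm : MemLp (fun t => generatorResolvent (G t)) 2 volume :=
    generatorResolvent.comp_memLp' hG
  have hmi : ∀ a b, IntervalIntegrable (fun t => generatorResolvent (G t)) volume a b :=
    fun a b => (hm.locallyIntegrable_two.integrableOn_isCompact isCompact_uIcc).intervalIntegrable
  set M : ℝ → L2R := fun t =>
    Sobolev.comp 1 0 z.fst + ∫ s in (0 : ℝ)..t, generatorResolvent (G s) with hM
  have hM0 : M 0 = Sobolev.comp 1 0 z.fst := by simp [hM]
  have hmono : ∀ s t, 0 ≤ s → s ≤ t → ‖M s‖ ^ 2 ≤ ‖M t‖ ^ 2 := by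
    intro s t hs hst
    have hMs : ∀ r ∈ Icc s t, M r = M s + ∫ q in s..r, generatorResolvent (G q) := by
      intro r _
      rw [hM]
      simp only
      rw [add_assoc, intervalIntegral.integral_add_adjacent_intervals (hmi 0 s) (hmi s r)]
    have h := integral_inner_add_inner_eq_sub hst (hmi s t) hMs (hmi s t) hMs
    rw [real_inner_self_eq_norm_sq, real_inner_self_eq_norm_sq] at h
    have hnn : 0 ≤ ∫ r in s..t, (⟪M r, generatorResolvent (G r)⟫ +
        ⟪generatorResolvent (G r), M r⟫) := by
      refine intervalIntegral.integral_nonneg_of_ae_restrict hst ?_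
      have h3 := ae_restrict_of_ae_restrict_of_subset
        (Icc_subset_Ici_self.trans (Ici_subset_Ici.2 hs) : Icc s t ⊆ Ici 0) hae
      filter_upwards [h3] with r hr
      have hr' : resolvent₀ (G r) = M r := hr
      have := inner_generatorResolvent_resolvent₀_nonneg (G r)
      rw [← hr', real_inner_comm]
      exact add_nonneg this this
    linarith
  have hMi : Integrable (fun t => ‖M t‖ ^ 2) halfLine := by
    have h1 : MemLp (fun t => resolvent₀ (G t)) 2 halfLine :=
      (resolvent₀.comp_memLp' hG).restrict _
    have h2 : MemLp M 2 halfLine := h1.ae_eq hae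
    exact h2.integrable_norm_pow (by simp)
  have hMz : ∀ s, 0 ≤ s → M s = 0 := by
    intro s hs
    by_contra hne
    have h1 : IntegrableOn (fun _ : ℝ => ‖M s‖ ^ 2) (Ici s) volume := by
      refine Integrable.mono' (IntegrableOn.mono_set hMi (Ici_subset_Ici.2 hs))
        aestronglyMeasurable_const ?_
      filter_upwards [ae_restrict_mem measurableSet_Ici] with t ht
      rw [Real.norm_of_nonneg (by positivity)]
      exact hmono s t hs ht
    -- By monotonicity a positive constant would be integrable over [s,∞), a set of infinite
    -- measure.
    rw [integrableOn_const_iff] at h1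
    rcases h1 with h1 | h1
    · simp [hne] at h1
    · simp at h1
  have hb : z.fst = 0 := by
    refine Sobolev.fn_injective 1 ?_
    rw [Sobolev.fn_eq_comp, ← hM0, hMz 0 le_rfl]
    exact (map_zero (Sobolev.comp 1 0)).symm
  have hg : z.snd = 0 := by
    apply Lp.ext
    filter_upwards [hGz, hae, ae_restrict_mem measurableSet_Ici,
      Lp.coeFn_zero L2R 2 halfLine] with t h1 h2 h3 h4
    rw [← h1, h4]
    exact resolvent₀_injective (h2.trans (hMz t h3))
  exact (WithLp.ofLp_injective 2) (Prod.ext hb hg)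

/-! ### The killed equation: density and energy estimates -/

theorem Trajectory.denseRange_data_of_forall_inner {B : ℝ → L2R →L[ℝ] L2R} (hB : PreservesMemLp B)
    (h : ∀ z, (∀ V, ⟪z, Trajectory.data hB V⟫ = 0) → z = 0) :
    DenseRange (Trajectory.data hB) := by
  have h1 : (LinearMap.range (Trajectory.data hB))ᗮ = ⊥ := by
    rw [Submodule.eq_bot_iff]
    intro z hz
    refine h z fun V => ?_
    rw [Submodule.mem_orthogonal'] at hz
    exact hz _ ⟨V, rfl⟩
  rw [← Submodule.topologicalClosure_eq_top_iff] at h1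
  have h2 := Submodule.dense_iff_topologicalClosure_eq_top.2 h1
  rwa [LinearMap.coe_range] at h2

/-- A perturbation argument: if z is orthogonal to the data with B, then its product with the data
without B is -⟪z.snd, BV⟫, and the squared norm of BV is at most half that of the data without B. As
the latter data are dense, the functional ⟪z, ·⟫ has norm at most ‖z‖/√2, which forces z = 0. -/
theorem Trajectory.denseRange_data {B : ℝ → L2R →L[ℝ] L2R} (hB : PreservesMemLp B)
    (hB1 : ∀ t f, ‖B t f‖ ≤ ‖f‖) : DenseRange (Trajectory.data hB) := by
  have hd := Trajectory.denseRange_data_of_forall_inner preservesMemLp_zero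
    fun z hz => eq_zero_of_forall_inner_data hz
  refine Trajectory.denseRange_data_of_forall_inner hB fun z hz => ?_
  have key : ∀ y : CauchyData, 2 * ⟪z, y⟫ ^ 2 ≤ ‖z‖ ^ 2 * ‖y‖ ^ 2 := by
    intro y
    refine hd.induction_on y (isClosed_le (by fun_prop) (by fun_prop)) fun V => ?_
    have hBV := hB _ (Trajectory.memLp_comp V 0)
    have e : ⟪z, Trajectory.data preservesMemLp_zero V⟫ = -⟪z.snd, hBV.toLp⟫ := by
      rw [eq_neg_iff_add_eq_zero, ← hz V, Trajectory.inner_data, Trajectory.inner_data, add_assoc]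
      refine congrArg (fun r => ⟪z.fst, Sobolev.incl (V.1 0)⟫ + r) ?_
      rw [MeasureTheory.L2.inner_def, ← integral_add]
      · refine integral_congr_ae ?_
        filter_upwards [hBV.coeFn_toLp] with t ht
        rw [ht, ← inner_add_right, Trajectory.source, Trajectory.source, Pi.zero_apply,
          _root_.zero_apply, add_zero]
      · have := L2.integrable_inner (𝕜 := ℝ) z.snd (Trajectory.memLp_source preservesMemLp_zero V).toLp
        refine this.congr ?_
        filter_upwards [(Trajectory.memLp_source preservesMemLp_zero V).coeFn_toLp] with t ht
        rw [ht]
      · exact L2.integrable_inner (𝕜 := ℝ) z.snd hBV.toLp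
    have h1 : ‖hBV.toLp‖ ^ 2 ≤ 1 / 2 * ‖Trajectory.data preservesMemLp_zero V‖ ^ 2 := by
      rw [hBV.norm_sq_toLp]
      refine le_trans (integral_mono (hBV.integrable_norm_pow (by simp))
        ((Trajectory.memLp_comp V 0).integrable_norm_pow (by simp)) fun t => ?_)
        (Trajectory.integral_norm_sq_le V)
      have := hB1 t (Sobolev.comp 2 0 (V.1 t))
      simp only
      gcongr
    have h2 : ‖z.snd‖ ^ 2 ≤ ‖z‖ ^ 2 := by
      rw [WithLp.prod_norm_sq_eq_of_L2]
      exact le_add_of_nonneg_left (sq_nonneg _)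
    have h3 : ⟪z.snd, hBV.toLp⟫ ^ 2 ≤ ‖z.snd‖ ^ 2 * ‖hBV.toLp‖ ^ 2 := by
      rw [← mul_pow, ← sq_abs]
      exact pow_le_pow_left₀ (abs_nonneg _) (abs_real_inner_le_norm _ _) 2
    rw [e, neg_sq]
    calc 2 * ⟪z.snd, hBV.toLp⟫ ^ 2 ≤ 2 * (‖z.snd‖ ^ 2 * ‖hBV.toLp‖ ^ 2) := by gcongr
      _ ≤ 2 * (‖z‖ ^ 2 * (1 / 2 * ‖Trajectory.data preservesMemLp_zero V‖ ^ 2)) := by gcongr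
      _ = _ := by ring
  -- At y = z the inequality reads 2‖z‖⁴ ≤ ‖z‖⁴.
  have hzz := key z
  rw [real_inner_self_eq_norm_sq] at hzz
  have : ‖z‖ ^ 2 = 0 := by nlinarith [sq_nonneg (‖z‖ ^ 2)]
  simpa using this

/-- Moves the derivative off the second argument, so that the equation can be inserted there without
differentiating the potential or the source. -/
theorem Sobolev.inner_incl_incl (f g : Sobolev 2) :
    ⟪Sobolev.incl f, Sobolev.incl g⟫ =
      ⟪Sobolev.comp 2 0 f - Sobolev.comp 2 2 f, Sobolev.comp 2 0 g⟫ := by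
  rw [Sobolev.inner_one, inner_sub_left, sub_eq_add_neg]
  exact congrArg _ (Sobolev.inner_comp_one_comp_one f (Sobolev.incl g))

/-- The basic energy inequality in `H¹(ℝ)`. -/
theorem Trajectory.inner_incl_deriv_le (c : ℝ → ℝ) (V : Trajectory) (t : ℝ) :
    2 * ⟪Sobolev.incl (V.1 t), Sobolev.incl (deriv V.1 t)⟫ ≤
      2 * ⟪Sobolev.comp 2 0 (V.1 t) - Sobolev.comp 2 2 (V.1 t),
        Trajectory.source (fun t => cutoff (c t)) V t⟫ - 4 * ‖Sobolev.comp 2 0 (V.1 t)‖ ^ 2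
        - 5 * ‖Sobolev.comp 2 1 (V.1 t)‖ ^ 2 - 1 / 2 * ‖Sobolev.comp 2 2 (V.1 t)‖ ^ 2 := by
  rw [Sobolev.inner_incl_incl, Trajectory.comp_zero_deriv (fun t => cutoff (c t)) V t]
  have h1 := Sobolev.norm_comp_one_sq (V.1 t)
  have h2 := inner_cutoff_self (c t) (Sobolev.comp 2 0 (V.1 t))
  set v := Sobolev.comp 2 0 (V.1 t)
  set x := Sobolev.comp 2 2 (V.1 t)
  set C := cutoff (c t) v
  set F := Trajectory.source (fun t => cutoff (c t)) V t
  have h3 := abs_le.1 (abs_real_inner_le_norm x C)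
  have h4 := real_inner_comm x v
  simp only [inner_sub_left, inner_sub_right, inner_add_right, real_inner_smul_right,
    real_inner_self_eq_norm_sq]
  -- The square gives 2‖x‖‖C‖ ≤ ½‖x‖² + 2‖C‖². The diffusion term -‖x‖² absorbs the first summand,
  -- and -2⟪v, C⟫ = -2‖C‖² cancels the second.
  nlinarith [sq_nonneg (‖x‖ - 2 * ‖C‖)]

theorem Trajectory.hasDerivAt_norm_sq_incl (V : Trajectory) (t : ℝ) :
    HasDerivAt (fun t => ‖Sobolev.incl (V.1 t)‖ ^ 2)
      (2 * ⟪Sobolev.incl (V.1 t), Sobolev.incl (deriv V.1 t)⟫) t :=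
  (Sobolev.incl.hasFDerivAt.comp_hasDerivAt t (Trajectory.hasDerivAt V t)).norm_sq

theorem Trajectory.continuous_inner_incl_deriv (V : Trajectory) :
    Continuous fun t => 2 * ⟪Sobolev.incl (V.1 t), Sobolev.incl (deriv V.1 t)⟫ :=
  continuous_const.mul ((Sobolev.incl.continuous.comp V.2.1.continuous).inner
    (Sobolev.incl.continuous.comp (Trajectory.continuous_deriv V)))

/-- The source is split by 2‖v‖‖F‖ ≤ ‖v‖² + ‖F‖² and 2‖x‖‖F‖ ≤ ¼‖x‖² + 4‖F‖², whence the 5; what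
remains of -½‖x‖² is -¼‖x‖², whence the ¼. This version only serves to show that the data control
the trajectory. -/
theorem Trajectory.energy_deriv_le (c : ℝ → ℝ) (V : Trajectory) (t : ℝ) :
    2 * ⟪Sobolev.incl (V.1 t), Sobolev.incl (deriv V.1 t)⟫ ≤
      -(1 / 4 * ‖V.1 t‖ ^ 2) + 5 * ‖Trajectory.source (fun t => cutoff (c t)) V t‖ ^ 2 := by
  refine (Trajectory.inner_incl_deriv_le c V t).trans ?_
  rw [Sobolev.norm_sq_two, inner_sub_left]
  set v := Sobolev.comp 2 0 (V.1 t)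
  set x := Sobolev.comp 2 2 (V.1 t)
  set F := Trajectory.source (fun t => cutoff (c t)) V t
  have h1 := abs_le.1 (abs_real_inner_le_norm v F)
  have h2 := abs_le.1 (abs_real_inner_le_norm x F)
  nlinarith [sq_nonneg (‖v‖ - ‖F‖), sq_nonneg (‖x‖ - 4 * ‖F‖), sq_nonneg ‖v‖,
    sq_nonneg ‖Sobolev.comp 2 1 (V.1 t)‖]

theorem Trajectory.norm_sq_incl_le {c : ℝ → ℝ} (hc : AEMeasurable c halfLine) (V : Trajectory) {t : ℝ}
    (ht : 0 ≤ t) :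
    ‖Sobolev.incl (V.1 t)‖ ^ 2 ≤ 5 * ‖Trajectory.data (preservesMemLp_cutoff hc) V‖ ^ 2 := by
  have hi : Continuous fun s => 1 / 4 * ‖V.1 s‖ ^ 2 :=
    continuous_const.mul (V.2.1.continuous.norm.pow 2)
  have h := add_integral_le_of_deriv_le (Trajectory.hasDerivAt_norm_sq_incl V)
    (Trajectory.continuous_inner_incl_deriv V) ht (hi.intervalIntegrable 0 t)
    (((Trajectory.memLp_source (preservesMemLp_cutoff hc) V).integrable_norm_pow
      (by simp)).const_mul 5) (fun s => by positivity)
    (fun s _ => Trajectory.energy_deriv_le c V s)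
  have h0 : 0 ≤ ∫ s in (0 : ℝ)..t, 1 / 4 * ‖V.1 s‖ ^ 2 :=
    intervalIntegral.integral_nonneg ht fun s _ => by positivity
  rw [integral_const_mul] at h
  rw [Trajectory.norm_data_sq]
  linarith [sq_nonneg ‖Sobolev.incl (V.1 0)‖]

theorem Trajectory.integral_norm_sq_trajectory_le {c : ℝ → ℝ} (hc : AEMeasurable c halfLine) (V : Trajectory) :
    ∫ t, ‖V.1 t‖ ^ 2 ∂halfLine ≤ 20 * ‖Trajectory.data (preservesMemLp_cutoff hc) V‖ ^ 2 := by
  have h := integral_halfLine_le_of_deriv_le (Trajectory.hasDerivAt_norm_sq_incl V)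
    (Trajectory.continuous_inner_incl_deriv V)
    (((Trajectory.memLp V).integrable_norm_pow (by simp)).const_mul (1 / 4))
    (((Trajectory.memLp_source (preservesMemLp_cutoff hc) V).integrable_norm_pow
      (by simp)).const_mul 5) (fun s => by positivity) (fun s => sq_nonneg _)
    (fun s => Trajectory.energy_deriv_le c V s)
  rw [integral_const_mul, integral_const_mul] at h
  rw [Trajectory.norm_data_sq]
  linarith [sq_nonneg ‖Sobolev.incl (V.1 0)‖]

/-! ### Limits of trajectories whose data converge to (u₀, 0). -/

theorem cauchySeq_of_dist_le_mul {α β : Type*} [PseudoMetricSpace α] [PseudoMetricSpace β]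
    {x : ℕ → α} {y : ℕ → β} {C : ℝ} (hC : 0 < C) (hx : CauchySeq x)
    (h : ∀ n m, dist (y n) (y m) ≤ C * dist (x n) (x m)) : CauchySeq y := by
  rw [Metric.cauchySeq_iff] at *
  intro ε hε
  obtain ⟨N, hN⟩ := hx (ε / C) (div_pos hε hC)
  refine ⟨N, fun n hn m hm => (h n m).trans_lt ?_⟩
  rw [mul_comm, ← lt_div_iff₀ hC]
  exact hN n hn m hm

/-- `V` approximates a solution of the equation for `e^{-2t} u`, with initial value `u₀`, by smooth
trajectories; `v` and `w` are the limits in `C([0,∞); H¹)` and `L²([0,∞); H²)`. -/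
structure IsApproximation (c : ℝ → ℝ) (u₀ : Sobolev 1) (V : ℕ → Trajectory)
    (v : ℝ → Sobolev 1) (w : Lp (Sobolev 2) 2 halfLine) (δ : ℕ → ℝ) : Prop where
  tendsto_zero : Tendsto δ atTop (𝓝 0)
  norm_sub_le : ∀ n t, 0 ≤ t → ‖Sobolev.incl ((V n).1 t) - v t‖ ≤ δ n
  tendsto_toLp : Tendsto (fun n => (Trajectory.memLp (V n)).toLp) atTop (𝓝 w)
  integral_source_le : ∀ n,
    ∫ t, ‖Trajectory.source (fun t => cutoff (c t)) (V n) t‖ ^ 2 ∂halfLine ≤ δ n ^ 2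
  initial : v 0 = u₀

/-- Density supplies trajectories with data tending to (u₀, 0). The energy bounds, applied to
differences of trajectories, turn convergence of the data into uniform convergence in H¹ and
convergence in L²([0,∞); H²). -/
theorem exists_isApproximation {c : ℝ → ℝ} (hc : AEMeasurable c halfLine) (u₀ : Sobolev 1) :
    ∃ V v w δ, IsApproximation c u₀ V v w δ := by
  have hB := preservesMemLp_cutoff hc
  set z : CauchyData := WithLp.toLp 2 (u₀, 0) with hz
  have hd := Trajectory.denseRange_data hB fun t => norm_cutoff_le (c t)
  obtain ⟨y, hy, hyz⟩ := mem_closure_iff_seq_limit.1 (hd z)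
  choose V hV using hy
  have hlim : Tendsto (fun n => Trajectory.data hB (V n)) atTop (𝓝 z) := by simpa only [hV] using hyz
  have hcau := hlim.cauchySeq
  have hLp : CauchySeq fun n => (Trajectory.memLp (V n)).toLp := by
    -- The constant 5 bounds √20, the square root of the constant in the L²(H²) estimate.
    refine cauchySeq_of_dist_le_mul (C := 5) (by norm_num) hcau fun n m => ?_
    rw [dist_eq_norm, dist_eq_norm, ← MemLp.toLp_sub, ← map_sub]
    refine (abs_le_of_sq_le_sq ?_ (mul_nonneg (by norm_num) (norm_nonneg _))).trans' (le_abs_self _)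
    have := Trajectory.integral_norm_sq_trajectory_le hc (V n - V m)
    have e := ((Trajectory.memLp (V n)).sub (Trajectory.memLp (V m))).norm_sq_toLp
    rw [e, mul_pow]
    refine this.trans ?_
    gcongr
    norm_num
  obtain ⟨w, hw⟩ := cauchySeq_tendsto_of_complete hLp
  -- The constant 3 bounds √5, from the pointwise H¹ estimate.
  have hdist : ∀ n m t, 0 ≤ t → dist (Sobolev.incl ((V n).1 t)) (Sobolev.incl ((V m).1 t)) ≤
      3 * dist (Trajectory.data hB (V n)) (Trajectory.data hB (V m)) := by
    intro n m t ht
    rw [dist_eq_norm, dist_eq_norm, ← map_sub, ← map_sub]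
    refine (abs_le_of_sq_le_sq ?_ (mul_nonneg (by norm_num) (norm_nonneg _))).trans' (le_abs_self _)
    have := Trajectory.norm_sq_incl_le hc (V n - V m) ht
    rw [mul_pow]
    refine this.trans ?_
    gcongr
    norm_num
  have hpt : ∀ t : ℝ, ∃ v : Sobolev 1, 0 ≤ t →
      Tendsto (fun n => Sobolev.incl ((V n).1 t)) atTop (𝓝 v) := by
    intro t
    by_cases ht : 0 ≤ t
    · obtain ⟨v, hv⟩ := cauchySeq_tendsto_of_complete
        (cauchySeq_of_dist_le_mul (C := 3) (by norm_num) hcau fun n m => hdist n m t ht)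
      exact ⟨v, fun _ => hv⟩
    · exact ⟨0, fun h => absurd h ht⟩
  choose v hv using hpt
  refine ⟨V, v, w, fun n => 3 * ‖Trajectory.data hB (V n) - z‖, ?_, ?_, hw, ?_, ?_⟩
  · have := (tendsto_iff_norm_sub_tendsto_zero.1 hlim).const_mul 3
    simpa using this
  · intro n t ht
    have h1 : Tendsto (fun m => dist (Sobolev.incl ((V n).1 t)) (Sobolev.incl ((V m).1 t))) atTop
        (𝓝 (dist (Sobolev.incl ((V n).1 t)) (v t))) := tendsto_const_nhds.dist (hv t ht)
    have h2 : Tendsto (fun m => 3 * dist (Trajectory.data hB (V n)) (Trajectory.data hB (V m)))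
        atTop (𝓝 (3 * dist (Trajectory.data hB (V n)) z)) :=
      (tendsto_const_nhds.dist hlim).const_mul 3
    rw [← dist_eq_norm, ← dist_eq_norm]
    exact le_of_tendsto_of_tendsto' h1 h2 fun m => hdist n m t ht
  · intro n
    rw [← (Trajectory.memLp_source hB (V n)).norm_sq_toLp]
    have h1 : ‖(Trajectory.memLp_source hB (V n)).toLp‖ ^ 2 ≤
        ‖Trajectory.data hB (V n) - z‖ ^ 2 := by
      rw [WithLp.prod_norm_sq_eq_of_L2 (Trajectory.data hB (V n) - z)]
      refine le_of_eq_of_le ?_ (le_add_of_nonneg_left (sq_nonneg _))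
      change _ = ‖(Trajectory.memLp_source hB (V n)).toLp - 0‖ ^ 2
      rw [sub_zero]
    rw [mul_pow]
    nlinarith [sq_nonneg ‖Trajectory.data hB (V n) - z‖]
  · refine tendsto_nhds_unique (hv 0 le_rfl) ?_
    have h1 : Tendsto (fun n => (Trajectory.data hB (V n)).fst) atTop (𝓝 z.fst) :=
      ((WithLp.continuous_fst 2 _ _).tendsto z).comp hlim
    exact h1

/-! ### Test functions on space-time as curves in `L²(ℝ)` -/

theorem L2R.ofTest_sub {η θ : ℝ → ℝ} (hη : Continuous η) (hηc : HasCompactSupport η)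
    (hθ : Continuous θ) (hθc : HasCompactSupport θ) :
    L2R.ofTest η hη hηc - L2R.ofTest θ hθ hθc = L2R.ofTest (η - θ) (hη.sub hθ) (hηc.sub hθc) :=
  (MemLp.toLp_sub _ _).symm

theorem L2R.ofTest_smul {η : ℝ → ℝ} (r : ℝ) (hη : Continuous η) (hηc : HasCompactSupport η) :
    r • L2R.ofTest η hη hηc = L2R.ofTest (r • η) (hη.const_smul r) (hηc.smul_left (f := fun _ => r)) :=
  (MemLp.toLp_const_smul r _).symm

/-- On a fixed bounded support, uniform smallness implies smallness in L². This carries the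
regularity of a space-time test function over to the corresponding curve. -/
theorem L2R.norm_ofTest_le {η : ℝ → ℝ} (hη : Continuous η) (hc : HasCompactSupport η) {R ε : ℝ}
    (hR : ∀ x, x ∉ Icc (-R) R → η x = 0) (hε : ∀ x, |η x| ≤ ε) :
    ‖L2R.ofTest η hη hc‖ ≤ ε * volume.real (Icc (-R) R) ^ (1 / 2 : ℝ) := by
  have hε0 : 0 ≤ ε := (abs_nonneg _).trans (hε 0)
  have hm : volume (Icc (-R) R) ≠ ⊤ := measure_Icc_lt_top.ne
  have h := norm_indicatorConstLp (p := 2) (μ := (volume : Measure ℝ)) (c := ε)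
    (hs := measurableSet_Icc) (hμs := hm) (by simp) (by simp)
  rw [Real.norm_of_nonneg hε0, ENNReal.toReal_ofNat] at h
  rw [← h]
  refine Lp.norm_le_norm_of_ae_le ?_
  filter_upwards [(hη.memLp_of_hasCompactSupport (p := 2) (μ := volume) hc).coeFn_toLp,
    indicatorConstLp_coeFn (p := 2) (μ := (volume : Measure ℝ)) (c := ε)
      (hs := measurableSet_Icc) (hμs := hm)] with x h1 h2
  rw [L2R.ofTest, h1, h2]
  by_cases hx : x ∈ Icc (-R) R
  · rw [indicator_of_mem hx, Real.norm_eq_abs, Real.norm_of_nonneg hε0]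
    exact hε x
  · rw [hR x hx, norm_zero]
    exact norm_nonneg _

section

variable {ψ : ℝ → ℝ → ℝ}

theorem HasCompactSupport.section_right (hc : HasCompactSupport (Function.uncurry ψ)) (t : ℝ) :
    HasCompactSupport (ψ t) :=
  hc.comp_isClosedEmbedding (g := Prod.mk t) ⟨isEmbedding_prodMkRight t, by
    have : range (Prod.mk t : ℝ → ℝ × ℝ) = {t} ×ˢ univ := by
      ext ⟨a, b⟩
      simp [eq_comm]
    rw [this]
    exact isClosed_singleton.prod isClosed_univ⟩

theorem Continuous.section_right (h : Continuous (Function.uncurry ψ)) (t : ℝ) :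
    Continuous (ψ t) :=
  h.comp (continuous_const.prodMk continuous_id)

theorem HasCompactSupport.exists_forall_eq_zero (hc : HasCompactSupport (Function.uncurry ψ)) :
    ∃ R, (∀ t x, x ∉ Icc (-R) R → ψ t x = 0) ∧ ∀ t x, R ≤ t → ψ t x = 0 := by
  obtain ⟨R, hR⟩ := hc.isCompact.isBounded.subset_closedBall 0
  have key : ∀ t x, ψ t x ≠ 0 → |t| ≤ R ∧ |x| ≤ R := by
    intro t x h
    have := hR (subset_tsupport _ (show Function.uncurry ψ (t, x) ≠ 0 from h))
    rw [mem_closedBall_zero_iff, Prod.norm_def, max_le_iff] at this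
    exact this
  -- The margin 1 lets the second claim include the endpoint t = R + 1.
  refine ⟨R + 1, fun t x hx => ?_, fun t x ht => ?_⟩
  · by_contra h
    have := abs_le.1 (key t x h).2
    exact hx ⟨by linarith, by linarith⟩
  · by_contra h
    have := abs_le.1 (key t x h).1
    linarith

/-- A compactly supported function on space-time as a curve in `L²(ℝ)`. -/
noncomputable def testCurve (ψ : ℝ → ℝ → ℝ) (h : Continuous (Function.uncurry ψ))
    (hc : HasCompactSupport (Function.uncurry ψ)) (t : ℝ) : L2R :=
  L2R.ofTest (ψ t) (h.section_right t) (hc.section_right t)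

theorem continuous_testCurve (h : Continuous (Function.uncurry ψ))
    (hc : HasCompactSupport (Function.uncurry ψ)) : Continuous (testCurve ψ h hc) := by
  obtain ⟨R, hR, -⟩ := hc.exists_forall_eq_zero
  have hu := hc.uniformContinuous_of_continuous h
  set K := volume.real (Icc (-R) R) ^ (1 / 2 : ℝ)
  have hK : 0 ≤ K := by positivity
  rw [Metric.continuous_iff]
  intro t ε hε
  -- Dividing by K + 1 rather than K avoids the case K = 0 and makes the final inequality strict.
  obtain ⟨δ, hδ, H⟩ := Metric.uniformContinuous_iff.1 hu (ε / (K + 1)) (by positivity)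
  refine ⟨δ, hδ, fun s hs => ?_⟩
  rw [dist_eq_norm, testCurve, testCurve, L2R.ofTest_sub]
  have h1 := L2R.norm_ofTest_le (η := ψ s - ψ t) ((h.section_right s).sub (h.section_right t))
    ((hc.section_right s).sub (hc.section_right t)) (R := R) (ε := ε / (K + 1))
    (fun x hx => by rw [Pi.sub_apply, hR s x hx, hR t x hx, sub_zero])
    (fun x => by
      have := @H (s, x) (t, x) (by rw [Prod.dist_eq]; simpa using hs)
      exact this.le)
  refine h1.trans_lt ?_
  rw [div_mul_eq_mul_div, div_lt_iff₀ (by positivity)]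
  nlinarith

theorem hasDerivAt_testCurve {φ : ℝ → ℝ → ℝ} (h : Continuous (Function.uncurry φ))
    (hc : HasCompactSupport (Function.uncurry φ)) (h' : Continuous (Function.uncurry ψ))
    (hc' : HasCompactSupport (Function.uncurry ψ))
    (hd : ∀ t x, HasDerivAt (fun s => φ s x) (ψ t x) t) (t : ℝ) :
    HasDerivAt (testCurve φ h hc) (testCurve ψ h' hc' t) t := by
  obtain ⟨R, hR, -⟩ := hc.exists_forall_eq_zero
  obtain ⟨R', hR', -⟩ := hc'.exists_forall_eq_zero
  have hu := hc'.uniformContinuous_of_continuous h'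
  set S := max R R'
  have hS : ∀ x, x ∉ Icc (-S) S → x ∉ Icc (-R) R ∧ x ∉ Icc (-R') R' := fun x hx =>
    ⟨fun hx' => hx (Icc_subset_Icc (neg_le_neg (le_max_left _ _)) (le_max_left _ _) hx'),
      fun hx' => hx (Icc_subset_Icc (neg_le_neg (le_max_right _ _)) (le_max_right _ _) hx')⟩
  set K := volume.real (Icc (-S) S) ^ (1 / 2 : ℝ)
  have hK : 0 ≤ K := by positivity
  rw [hasDerivAt_iff_isLittleO, Asymptotics.isLittleO_iff]
  intro ε hε
  obtain ⟨δ, hδ, H⟩ := Metric.uniformContinuous_iff.1 hu (ε / (K + 1)) (by positivity)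
  filter_upwards [Metric.ball_mem_nhds t hδ] with s hs
  rw [testCurve, testCurve, testCurve, L2R.ofTest_smul, L2R.ofTest_sub, L2R.ofTest_sub]
  -- The mean value inequality for r ↦ φ(r,x) - rψ(t,x), whose derivative ψ(r,x) - ψ(t,x) is small
  -- uniformly in x; so the remainder is o(|s - t|) in L².
  have hmv : ∀ x, |φ s x - φ t x - (s - t) * ψ t x| ≤ ε / (K + 1) * |s - t| := by
    intro x
    have := Convex.norm_image_sub_le_of_norm_hasDerivWithin_le
      (f := fun r => φ r x - r * ψ t x) (f' := fun r => ψ r x - ψ t x) (s := Metric.ball t δ)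
      (C := ε / (K + 1)) (x := t) (y := s)
      (fun r _ => ((hd r x).sub ((hasDerivAt_id r).mul_const (ψ t x))).hasDerivWithinAt.congr_deriv
        (by simp)) (fun r hr => by
          have := @H (r, x) (t, x) (by rw [Prod.dist_eq]; simpa using hr)
          exact this.le) (convex_ball t δ) (Metric.mem_ball_self hδ) hs
    simp only [Real.norm_eq_abs] at this
    convert this using 2
    ring
  have h1 := L2R.norm_ofTest_le (η := φ s - φ t - (s - t) • ψ t)
    (((h.section_right s).sub (h.section_right t)).sub ((h'.section_right t).const_smul _))
    (((hc.section_right s).sub (hc.section_right t)).sub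
      ((hc'.section_right t).smul_left (f := fun _ => s - t))) (R := S)
    (ε := ε / (K + 1) * |s - t|)
    (fun x hx => by
      simp [hR s x (hS x hx).1, hR t x (hS x hx).1, hR' t x (hS x hx).2])
    (fun x => by simpa using hmv x)
  refine h1.trans ?_
  rw [Real.norm_eq_abs]
  have h2 : ε / (K + 1) * K ≤ ε := by
    rw [div_mul_eq_mul_div, div_le_iff₀ (by positivity)]
    nlinarith
  calc ε / (K + 1) * |s - t| * K = ε / (K + 1) * K * |s - t| := by ring
    _ ≤ ε * |s - t| := by gcongr

/-- The partial derivative in the direction `e`. -/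
noncomputable def partialDeriv (e : ℝ × ℝ) (ψ : ℝ → ℝ → ℝ) (t x : ℝ) : ℝ :=
  fderiv ℝ (Function.uncurry ψ) (t, x) e

theorem contDiff_partialDeriv (e : ℝ × ℝ) (h : ContDiff ℝ ∞ (Function.uncurry ψ)) :
    ContDiff ℝ ∞ (Function.uncurry (partialDeriv e ψ)) :=
  (h.fderiv_right (m := ∞) (by simp)).clm_apply contDiff_const

theorem hasCompactSupport_partialDeriv (e : ℝ × ℝ)
    (hc : HasCompactSupport (Function.uncurry ψ)) :
    HasCompactSupport (Function.uncurry (partialDeriv e ψ)) :=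
  hc.fderiv_apply (𝕜 := ℝ) e

theorem hasDerivAt_time (h : ContDiff ℝ ∞ (Function.uncurry ψ)) (t x : ℝ) :
    HasDerivAt (fun s => ψ s x) (partialDeriv (1, 0) ψ t x) t :=
  (h.differentiable (by simp) (t, x)).hasFDerivAt.comp_hasDerivAt (f := fun s => (s, x)) t
    ((hasDerivAt_id t).prodMk (hasDerivAt_const t x))

theorem hasDerivAt_space (h : ContDiff ℝ ∞ (Function.uncurry ψ)) (t x : ℝ) :
    HasDerivAt (ψ t) (partialDeriv (0, 1) ψ t x) x :=
  (h.differentiable (by simp) (t, x)).hasFDerivAt.comp_hasDerivAt (f := fun y => (t, y)) x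
    ((hasDerivAt_const x t).prodMk (hasDerivAt_id x))

theorem iteratedDeriv_two_section (h : ContDiff ℝ ∞ (Function.uncurry ψ)) (t : ℝ) :
    iteratedDeriv 2 (ψ t) = partialDeriv (0, 1) (partialDeriv (0, 1) ψ) t := by
  have h1 : deriv (ψ t) = partialDeriv (0, 1) ψ t :=
    funext fun x => (hasDerivAt_space h t x).deriv
  rw [iteratedDeriv_succ, iteratedDeriv_one, h1]
  exact funext fun x => (hasDerivAt_space (contDiff_partialDeriv _ h) t x).deriv

end

theorem Sobolev.inner_comp_two_ofTest (f : Sobolev 2) {η : ℝ → ℝ} (hη : ContDiff ℝ ∞ η)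
    (hc : HasCompactSupport η) :
    ⟪Sobolev.comp 2 2 f, L2R.ofTest η hη.continuous hc⟫ =
      ∫ x, Sobolev.comp 2 0 f x * iteratedDeriv 2 η x := by
  have hη' : ContDiff ℝ ∞ (deriv η) := (contDiff_infty_iff_deriv.1 hη).2
  have h1 : ∫ x, Sobolev.comp 2 1 f x * deriv η x = -∫ x, Sobolev.comp 2 2 f x * η x :=
    f.2 1 η hη hc
  have h0 : ∫ x, Sobolev.comp 2 0 f x * deriv (deriv η) x =
      -∫ x, Sobolev.comp 2 1 f x * deriv η x := f.2 0 (deriv η) hη' hc.deriv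
  rw [L2R.inner_ofTest, iteratedDeriv_succ, iteratedDeriv_one, h0, h1, neg_neg]

/-- A test function on space-time as a curve `Φ` in `L²(ℝ)`, together with its derivatives `Φt` in
time and `Φxx` in space. -/
structure IsTestCurve (c : ℝ → ℝ) (φ : ℝ → ℝ → ℝ) (Φ Φt Φxx : ℝ → L2R) : Prop where
  hasDerivAt : ∀ t, HasDerivAt Φ (Φt t) t
  continuous_time : Continuous Φt
  continuous_space : Continuous Φxx
  eventually_zero : ∃ R, ∀ t, R ≤ t → Φ t = 0
  inner_eq : ∀ (f : L2R) t, ⟪f, Φ t⟫ = ∫ x, f x * φ t x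
  inner_time : ∀ (f : L2R) t, ⟪f, Φt t⟫ = ∫ x, f x * deriv (fun s => φ s x) t
  inner_space : ∀ (f : L2R) t, ⟪f, Φxx t⟫ = ∫ x, f x * iteratedDeriv 2 (φ t) x
  inner_comp_two : ∀ (f : Sobolev 2) t,
    ⟪Sobolev.comp 2 2 f, Φ t⟫ = ⟪Sobolev.comp 2 0 f, Φxx t⟫
  inner_cutoff : ∀ (f : L2R) t, ⟪cutoff (c t) f, Φ t⟫ = ∫ x, killing c t x * f x * φ t x

theorem exists_isTestCurve (c : ℝ → ℝ) {φ : ℝ → ℝ → ℝ}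
    (h : ContDiff ℝ ∞ (Function.uncurry φ)) (hc : HasCompactSupport (Function.uncurry φ)) :
    ∃ Φ Φt Φxx, IsTestCurve c φ Φ Φt Φxx := by
  have ht := contDiff_partialDeriv (1, 0) h
  have htc := hasCompactSupport_partialDeriv (1, 0) hc
  have hx := contDiff_partialDeriv (0, 1) (contDiff_partialDeriv (0, 1) h)
  have hxc := hasCompactSupport_partialDeriv (0, 1) (hasCompactSupport_partialDeriv (0, 1) hc)
  have hs : ∀ t, ContDiff ℝ ∞ (φ t) := fun t => h.comp (contDiff_const.prodMk contDiff_id)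
  refine ⟨testCurve φ h.continuous hc, testCurve _ ht.continuous htc,
    testCurve _ hx.continuous hxc, ?_, continuous_testCurve _ _, continuous_testCurve _ _, ?_,
    fun f t => L2R.inner_ofTest _ _ _, fun f t => ?_, fun f t => ?_, fun f t => ?_,
    fun f t => inner_cutoff_ofTest c t f _ _⟩
  · exact fun t => hasDerivAt_testCurve h.continuous hc ht.continuous htc
      (fun t x => hasDerivAt_time h t x) t
  · obtain ⟨R, -, hR⟩ := hc.exists_forall_eq_zero
    refine ⟨R, fun t ht => ?_⟩
    have := L2R.norm_ofTest_le (h.continuous.section_right t) (hc.section_right t) (R := R) (ε := 0)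
      (fun x _ => hR t x ht) (fun x => by rw [hR t x ht, abs_zero])
    rw [zero_mul] at this
    exact norm_le_zero_iff.1 this
  · rw [testCurve, L2R.inner_ofTest]
    simp only [(hasDerivAt_time h t _).deriv]
  · rw [testCurve, L2R.inner_ofTest, iteratedDeriv_two_section h]
  · rw [testCurve, testCurve, Sobolev.inner_comp_two_ofTest f (hs t) (hc.section_right t),
      L2R.inner_ofTest, iteratedDeriv_two_section h]

/-! ### The solution of the killed equation -/

theorem MeasureTheory.MemLp.integral_norm_mul_norm_le {α E F : Type*} [MeasurableSpace α]
    {μ : Measure α} [NormedAddCommGroup E] [InnerProductSpace ℝ E] [NormedAddCommGroup F]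
    [InnerProductSpace ℝ F] {f : α → E} {g : α → F} (hf : MemLp f 2 μ) (hg : MemLp g 2 μ) :
    ∫ t, ‖f t‖ * ‖g t‖ ∂μ ≤ ‖hf.toLp‖ * ‖hg.toLp‖ := by
  have e : ∫ t, ‖f t‖ * ‖g t‖ ∂μ = ⟪hf.norm.toLp, hg.norm.toLp⟫ := by
    rw [MeasureTheory.L2.inner_def]
    refine integral_congr_ae ?_
    filter_upwards [hf.norm.coeFn_toLp, hg.norm.coeFn_toLp] with t h1 h2
    rw [h1, h2]
    simp [mul_comm]
  have hf' : ‖hf.norm.toLp‖ = ‖hf.toLp‖ := by rw [Lp.norm_toLp, Lp.norm_toLp, eLpNorm_norm]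
  have hg' : ‖hg.norm.toLp‖ = ‖hg.toLp‖ := by rw [Lp.norm_toLp, Lp.norm_toLp, eLpNorm_norm]
  rw [e, ← hf', ← hg']
  exact real_inner_le_norm _ _

theorem Sobolev.enorm_dx_sq (f : Sobolev 2) : ‖Sobolev.dx f‖ₑ ^ 2 =
    ENNReal.ofReal (‖Sobolev.comp 2 1 f‖ ^ 2 + ‖Sobolev.comp 2 2 f‖ ^ 2) := by
  rw [← Sobolev.norm_dx_sq, ENNReal.ofReal_pow (norm_nonneg _), ofReal_norm]

/-- The weight e^{4s} undoes the substitution u = e^{2s}v. Its derivative costs 4‖V‖² in H¹, which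
the terms -4‖v‖² and -5‖∂ₓv‖² cover, leaving -‖∂ₓv‖² - ½‖∂ₓ²v‖². The source is kept as a product
‖V‖‖F‖ rather than split by Young's inequality, so that it vanishes in the limit and the sharp bound
by ‖u₀‖² survives. -/
theorem Trajectory.norm_sq_incl_add_integral_le {c : ℝ → ℝ} (hc : AEMeasurable c halfLine)
    (V : Trajectory) {t : ℝ} (ht : 0 ≤ t) :
    Real.exp (4 * t) * ‖Sobolev.incl (V.1 t)‖ ^ 2 + ∫ s in (0 : ℝ)..t, 1 / 2 * (Real.exp (4 * s) *
        (‖Sobolev.comp 2 1 (V.1 s)‖ ^ 2 + ‖Sobolev.comp 2 2 (V.1 s)‖ ^ 2)) ≤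
      ‖Sobolev.incl (V.1 0)‖ ^ 2 + 4 * Real.exp (4 * t) *
        ∫ s, ‖V.1 s‖ * ‖Trajectory.source (fun t => cutoff (c t)) V s‖ ∂halfLine := by
  have he : ∀ s : ℝ, HasDerivAt (fun s => Real.exp (4 * s)) (Real.exp (4 * s) * (4 * 1)) s :=
    fun s => ((hasDerivAt_id s).const_mul 4).exp
  have hec : Continuous fun s : ℝ => Real.exp (4 * s) := by fun_prop
  have hVc : Continuous V.1 := V.2.1.continuous
  have hi : ∀ i, Continuous fun s => ‖Sobolev.comp 2 i (V.1 s)‖ ^ 2 := fun i =>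
    ((Sobolev.comp 2 i).continuous.comp hVc).norm.pow 2
  have hF := Trajectory.memLp_source (preservesMemLp_cutoff hc) V
  have h := add_integral_le_of_deriv_le
    (φ := fun s => Real.exp (4 * s) * ‖Sobolev.incl (V.1 s)‖ ^ 2)
    (φ' := fun s => Real.exp (4 * s) * (4 * 1) * ‖Sobolev.incl (V.1 s)‖ ^ 2 +
      Real.exp (4 * s) * (2 * ⟪Sobolev.incl (V.1 s), Sobolev.incl (deriv V.1 s)⟫))
    (a := fun s => 1 / 2 * (Real.exp (4 * s) *
        (‖Sobolev.comp 2 1 (V.1 s)‖ ^ 2 + ‖Sobolev.comp 2 2 (V.1 s)‖ ^ 2)))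
    (b := fun s => 4 * Real.exp (4 * t) *
      (‖V.1 s‖ * ‖Trajectory.source (fun t => cutoff (c t)) V s‖))
    (fun s => (he s).mul (Trajectory.hasDerivAt_norm_sq_incl V s))
    (((hec.mul continuous_const).mul ((Sobolev.incl.continuous.comp hVc).norm.pow 2)).add
      (hec.mul (Trajectory.continuous_inner_incl_deriv V))) ht
    ((continuous_const.mul (hec.mul ((hi 1).add (hi 2)))).intervalIntegrable 0 t)
    (((Trajectory.memLp V).norm.integrable_mul hF.norm).const_mul _)
    (fun s => by positivity) (fun s hs => by
      have h1 := Trajectory.inner_incl_deriv_le c V s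
      have h2 := Sobolev.norm_sq_one (Sobolev.incl (V.1 s))
      rw [Sobolev.comp_zero_incl, Sobolev.comp_one_incl] at h2
      set F := Trajectory.source (fun t => cutoff (c t)) V s
      have h3 : ⟪Sobolev.comp 2 0 (V.1 s) - Sobolev.comp 2 2 (V.1 s), F⟫ ≤ 2 * (‖V.1 s‖ * ‖F‖) := by
        refine (real_inner_le_norm _ _).trans ?_
        rw [← mul_assoc]
        gcongr
        refine (norm_sub_le _ _).trans ?_
        linarith [Sobolev.norm_comp_le 0 (V.1 s), Sobolev.norm_comp_le 2 (V.1 s)]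
      have h4 : Real.exp (4 * s) ≤ Real.exp (4 * t) := Real.exp_le_exp.2 (by linarith [hs.2])
      have h5 : 0 ≤ ‖V.1 s‖ * ‖F‖ := by positivity
      have h6 : 4 * ‖Sobolev.incl (V.1 s)‖ ^ 2 +
          2 * ⟪Sobolev.incl (V.1 s), Sobolev.incl (deriv V.1 s)⟫ ≤
          -(1 / 2 * (‖Sobolev.comp 2 1 (V.1 s)‖ ^ 2 + ‖Sobolev.comp 2 2 (V.1 s)‖ ^ 2))
            + 4 * (‖V.1 s‖ * ‖F‖) := by
        nlinarith [sq_nonneg ‖Sobolev.comp 2 1 (V.1 s)‖]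
      have h7 := mul_le_mul_of_nonneg_left h6 (Real.exp_pos (4 * s)).le
      have h8 := mul_le_mul_of_nonneg_right h4 h5
      linarith)
  rw [integral_const_mul] at h
  simpa using h

theorem intervalIntegrable_cutoff {c : ℝ → ℝ} (hc : AEMeasurable c halfLine) {f : ℝ → L2R} {T : ℝ}
    (hT : 0 ≤ T) (hf : ContinuousOn f (Icc 0 T)) :
    IntervalIntegrable (fun t => cutoff (c t) (f t)) volume 0 T := by
  have hi : IntervalIntegrable f volume 0 T :=
    ContinuousOn.intervalIntegrable (by rwa [uIcc_of_le hT])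
  rw [intervalIntegrable_iff_integrableOn_Ioc_of_le hT] at hi ⊢
  have hsub : Ioc 0 T ⊆ Ici (0 : ℝ) := fun s hs => hs.1.le
  exact Integrable.mono hi (hi.aestronglyMeasurable.cutoff
    (hc.mono_measure (Measure.restrict_mono_set _ hsub)))
    (Eventually.of_forall fun t => norm_cutoff_le _ _)

theorem IntervalIntegrable.inner_continuousOn {E : Type*} [NormedAddCommGroup E]
    [InnerProductSpace ℝ E] {f g : ℝ → E} {a b : ℝ} (hf : IntervalIntegrable f volume a b)
    (hg : ContinuousOn g (uIcc a b)) : IntervalIntegrable (fun t => ⟪f t, g t⟫) volume a b := by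
  have h1 := hf.norm.mul_continuousOn hg.norm
  refine h1.mono_fun ?_ (Eventually.of_forall fun t => ?_)
  · rw [intervalIntegrable_iff] at hf
    exact hf.aestronglyMeasurable.inner
      ((hg.mono uIoc_subset_uIcc).aestronglyMeasurable measurableSet_uIoc)
  · simp only [norm_mul, norm_norm]
    exact norm_inner_le_norm _ _

namespace IsApproximation

variable {c : ℝ → ℝ} {u₀ : Sobolev 1} {V : ℕ → Trajectory} {v : ℝ → Sobolev 1}
  {w : Lp (Sobolev 2) 2 halfLine} {δ : ℕ → ℝ}

theorem nonneg (h : IsApproximation c u₀ V v w δ) (n : ℕ) : 0 ≤ δ n :=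
  (norm_nonneg _).trans (h.norm_sub_le n 0 le_rfl)

theorem tendsto_incl (h : IsApproximation c u₀ V v w δ) {t : ℝ} (ht : 0 ≤ t) :
    Tendsto (fun n => Sobolev.incl ((V n).1 t)) atTop (𝓝 (v t)) := by
  rw [tendsto_iff_norm_sub_tendsto_zero]
  exact squeeze_zero (fun n => norm_nonneg _) (fun n => h.norm_sub_le n t ht) h.tendsto_zero

theorem continuousOn (h : IsApproximation c u₀ V v w δ) : ContinuousOn v (Ici 0) := by
  refine TendstoUniformlyOn.continuousOn (F := fun n t => Sobolev.incl ((V n).1 t)) (p := atTop)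
    ?_ (Frequently.of_forall fun n =>
      (Sobolev.incl.continuous.comp (V n).2.1.continuous).continuousOn)
  rw [Metric.tendstoUniformlyOn_iff]
  intro ε hε
  filter_upwards [h.tendsto_zero.eventually_lt_const hε] with n hn t ht
  rw [dist_comm, dist_eq_norm]
  exact (h.norm_sub_le n t ht).trans_lt hn

theorem exists_subseq (h : IsApproximation c u₀ V v w δ) : ∃ ns : ℕ → ℕ, StrictMono ns ∧
    ∀ᵐ t ∂halfLine, Tendsto (fun k => (V (ns k)).1 t) atTop (𝓝 (w t)) := by
  obtain ⟨ns, hns, hlim⟩ := (tendstoInMeasure_of_tendsto_Lp h.tendsto_toLp).exists_seq_tendsto_ae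
  refine ⟨ns, hns, ?_⟩
  have hae : ∀ᵐ t ∂halfLine, ∀ k,
      (MemLp.toLp _ (Trajectory.memLp (V (ns k)))) t = (V (ns k)).1 t :=
    ae_all_iff.2 fun k => (Trajectory.memLp (V (ns k))).coeFn_toLp
  filter_upwards [hlim, hae] with t h1 h2
  simpa only [h2] using h1

/-- Along a subsequence the trajectories converge to w(t) in H² for almost every t, and they
converge to v(t) in H¹ for every t ≥ 0; the limits agree. -/
theorem ae_incl_eq (h : IsApproximation c u₀ V v w δ) :
    ∀ᵐ t ∂halfLine, Sobolev.incl (w t) = v t := by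
  obtain ⟨ns, hns, hlim⟩ := h.exists_subseq
  filter_upwards [hlim, ae_restrict_mem measurableSet_Ici] with t h1 ht
  exact tendsto_nhds_unique ((Sobolev.incl.continuous.tendsto _).comp h1)
    ((h.tendsto_incl ht).comp hns.tendsto_atTop)

theorem isH2Version (h : IsApproximation c u₀ V v w δ) :
    IsH2Version (fun t => Real.exp (2 * t) • v t) fun t => Real.exp (2 * t) • w t := by
  filter_upwards [h.ae_incl_eq] with t ht
  rw [Sobolev.fn_eq_comp, Sobolev.fn_eq_comp, map_smul, map_smul, ← ht, Sobolev.comp_zero_incl]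

theorem memL2H2 (h : IsApproximation c u₀ V v w δ) :
    MemL2H2 fun t => Real.exp (2 * t) • v t := by
  refine ⟨_, h.isH2Version, fun T _ => ?_⟩
  have h1 : MemLp w 2 (volume.restrict (Icc 0 T)) :=
    (Lp.memLp w).mono_measure (Measure.restrict_mono_set _ Icc_subset_Ici_self)
  have hec : Continuous fun s : ℝ => Real.exp (2 * s) := by fun_prop
  refine h1.of_le_mul (c := Real.exp (2 * T))
    (hec.aestronglyMeasurable.smul h1.aestronglyMeasurable) ?_
  filter_upwards [ae_restrict_mem measurableSet_Icc] with t ht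
  rw [norm_smul, Real.norm_of_nonneg (Real.exp_pos _).le]
  gcongr
  exact ht.2

/-- The right-hand side of the energy inequality for the approximations. -/
theorem exists_tendsto_bound (h : IsApproximation c u₀ V v w δ) (hc : AEMeasurable c halfLine)
    {t : ℝ} (ht : 0 ≤ t) : ∃ b : ℕ → ℝ, Tendsto b atTop (𝓝 (‖u₀‖ ^ 2)) ∧ ∀ n,
      Real.exp (4 * t) * ‖Sobolev.incl ((V n).1 t)‖ ^ 2 +
        ∫ s in (0 : ℝ)..t, 1 / 2 * (Real.exp (4 * s) *
          (‖Sobolev.comp 2 1 ((V n).1 s)‖ ^ 2 + ‖Sobolev.comp 2 2 ((V n).1 s)‖ ^ 2)) ≤ b n := by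
  refine ⟨fun n => ‖Sobolev.incl ((V n).1 0)‖ ^ 2 +
    4 * Real.exp (4 * t) * (‖(Trajectory.memLp (V n)).toLp‖ * δ n), ?_, fun n => ?_⟩
  · have h1 := ((h.tendsto_incl le_rfl).norm.pow 2).add
      ((((continuous_norm.tendsto w).comp h.tendsto_toLp).mul h.tendsto_zero).const_mul (4 * Real.exp (4 * t)))
    simpa [h.initial] using h1
  · refine (Trajectory.norm_sq_incl_add_integral_le hc (V n) ht).trans ?_
    dsimp only
    gcongr
    have hF := Trajectory.memLp_source (preservesMemLp_cutoff hc) (V n)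
    refine ((Trajectory.memLp (V n)).integral_norm_mul_norm_le hF).trans ?_
    gcongr
    refine (sq_le_sq₀ (norm_nonneg _) (h.nonneg n)).1 ?_
    rw [hF.norm_sq_toLp]
    exact h.integral_source_le n

theorem norm_le (h : IsApproximation c u₀ V v w δ) (hc : AEMeasurable c halfLine)
    {t : ℝ} (ht : 0 ≤ t) : ‖Real.exp (2 * t) • v t‖ ≤ ‖u₀‖ := by
  obtain ⟨b, hb, hle⟩ := h.exists_tendsto_bound hc ht
  refine (sq_le_sq₀ (norm_nonneg _) (norm_nonneg _)).1 ?_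
  have e : ‖Real.exp (2 * t) • v t‖ ^ 2 = Real.exp (4 * t) * ‖v t‖ ^ 2 := by
    rw [norm_smul, Real.norm_of_nonneg (Real.exp_pos _).le, mul_pow, ← Real.exp_nat_mul]
    congr 2
    push_cast
    ring
  rw [e]
  refine le_of_tendsto_of_tendsto' (((h.tendsto_incl ht).norm.pow 2).const_mul _) hb fun n => ?_
  refine le_trans (le_add_of_nonneg_right ?_) (hle n)
  exact intervalIntegral.integral_nonneg ht fun s _ => by positivity

/-- Fatou's lemma along an almost everywhere convergent subsequence, applied to the dissipation
integrals of the approximations. -/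
theorem lintegral_dx_le (h : IsApproximation c u₀ V v w δ) (hc : AEMeasurable c halfLine)
    {T : ℝ} (hT : 0 ≤ T) :
    ∫⁻ t in Icc (0 : ℝ) T, ‖Sobolev.dx (Real.exp (2 * t) • w t)‖ₑ ^ 2 ≤ 4 * ‖u₀‖ₑ ^ 2 := by
  obtain ⟨b, hb, hle⟩ := h.exists_tendsto_bound hc hT
  obtain ⟨ns, hns, hlim⟩ := h.exists_subseq
  set q : Sobolev 2 → ℝ := fun f => ‖Sobolev.comp 2 1 f‖ ^ 2 + ‖Sobolev.comp 2 2 f‖ ^ 2 with hq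
  have hqc : Continuous q := by fun_prop
  have hec : Continuous fun s : ℝ => Real.exp (4 * s) := by fun_prop
  have hqe : ∀ (t : ℝ) f, q (Real.exp (2 * t) • f) = Real.exp (4 * t) * q f := by
    intro t f
    simp only [hq, map_smul, norm_smul, Real.norm_of_nonneg (Real.exp_pos _).le, mul_pow]
    rw [← Real.exp_nat_mul, ← mul_add]
    congr 2
    push_cast
    ring
  have hcont : ∀ n, Continuous fun t => Real.exp (4 * t) * q ((V n).1 t) := fun n =>
    hec.mul (hqc.comp (V n).2.1.continuous)
  have hn : ∀ n, ∫⁻ t in Icc (0 : ℝ) T, ENNReal.ofReal (Real.exp (4 * t) * q ((V n).1 t)) ≤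
      ENNReal.ofReal (2 * b n) := by
    intro n
    rw [← ofReal_integral_eq_lintegral_ofReal
      ((hcont n).continuousOn.integrableOn_compact isCompact_Icc)
      (Eventually.of_forall fun t => by simp only [hq, Pi.zero_apply]; positivity)]
    refine ENNReal.ofReal_le_ofReal ?_
    rw [integral_Icc_eq_integral_Ioc, ← intervalIntegral.integral_of_le hT]
    have h1 := hle n
    rw [intervalIntegral.integral_const_mul] at h1
    have h2 : 0 ≤ Real.exp (4 * T) * ‖Sobolev.incl ((V n).1 T)‖ ^ 2 := by positivity
    linarith
  have hlt : Tendsto (fun k => ENNReal.ofReal (2 * b (ns k))) atTop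
      (𝓝 (ENNReal.ofReal (2 * ‖u₀‖ ^ 2))) :=
    (ENNReal.continuous_ofReal.tendsto _).comp ((hb.comp hns.tendsto_atTop).const_mul 2)
  have hsub := ae_restrict_of_ae_restrict_of_subset (Icc_subset_Ici_self : Icc 0 T ⊆ Ici 0) hlim
  calc ∫⁻ t in Icc (0 : ℝ) T, ‖Sobolev.dx (Real.exp (2 * t) • w t)‖ₑ ^ 2
      = ∫⁻ t in Icc (0 : ℝ) T, liminf
          (fun k => ENNReal.ofReal (Real.exp (4 * t) * q ((V (ns k)).1 t))) atTop := by
        refine lintegral_congr_ae ?_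
        filter_upwards [hsub] with t ht
        have h1 : Tendsto (fun k => ENNReal.ofReal (Real.exp (4 * t) * q ((V (ns k)).1 t))) atTop
            (𝓝 (ENNReal.ofReal (Real.exp (4 * t) * q (w t)))) :=
          (ENNReal.continuous_ofReal.tendsto _).comp
            (((hqc.tendsto _).comp ht).const_mul _)
        rw [h1.liminf_eq, Sobolev.enorm_dx_sq, ← hqe]
    _ ≤ liminf (fun k => ∫⁻ t in Icc (0 : ℝ) T,
          ENNReal.ofReal (Real.exp (4 * t) * q ((V (ns k)).1 t))) atTop :=
        lintegral_liminf_le fun k => (hcont (ns k)).measurable.ennreal_ofReal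
    _ ≤ liminf (fun k => ENNReal.ofReal (2 * b (ns k))) atTop :=
        liminf_le_liminf (Eventually.of_forall fun k => hn (ns k))
    _ = ENNReal.ofReal (2 * ‖u₀‖ ^ 2) := hlt.liminf_eq
    -- The factor 2 is relaxed to the perfect square 4, whose root 2 leaves exactly room for the
    -- supremum in the constant 3.
    _ ≤ ENNReal.ofReal (4 * ‖u₀‖ ^ 2) := by
        refine ENNReal.ofReal_le_ofReal ?_
        nlinarith [sq_nonneg ‖u₀‖]
    _ = 4 * ‖u₀‖ₑ ^ 2 := by
        rw [ENNReal.ofReal_mul (by norm_num), ENNReal.ofReal_pow (norm_nonneg _), ofReal_norm]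
        norm_num

end IsApproximation

/-! ### The weak formulation -/

theorem IsTestCurve.continuous {c : ℝ → ℝ} {φ : ℝ → ℝ → ℝ} {Φ Φt Φxx : ℝ → L2R}
    (hΦ : IsTestCurve c φ Φ Φt Φxx) : Continuous Φ :=
  continuous_iff_continuousAt.2 fun t => (hΦ.hasDerivAt t).continuousAt

/-- The weak formulation for a smooth trajectory. -/
theorem Trajectory.integral_eq_sub {c : ℝ → ℝ} (hc : AEMeasurable c halfLine) (V : Trajectory)
    {φ : ℝ → ℝ → ℝ} {Φ Φt Φxx : ℝ → L2R} (hΦ : IsTestCurve c φ Φ Φt Φxx) {T : ℝ} (hT : 0 ≤ T) :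
    ∫ t in (0 : ℝ)..T, Real.exp (2 * t) *
        (⟪Sobolev.comp 2 0 (V.1 t), Φt t + (1 / 2 : ℝ) • Φxx t⟫
          - ⟪cutoff (c t) (Sobolev.comp 2 0 (V.1 t)), Φ t⟫) =
      Real.exp (2 * T) * ⟪Sobolev.comp 2 0 (V.1 T), Φ T⟫ - ⟪Sobolev.comp 2 0 (V.1 0), Φ 0⟫
        - ∫ t in (0 : ℝ)..T,
          Real.exp (2 * t) * ⟪Trajectory.source (fun t => cutoff (c t)) V t, Φ t⟫ := by
  have hec : Continuous fun s : ℝ => Real.exp (2 * s) := by fun_prop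
  have he : ∀ s : ℝ, HasDerivAt (fun s => Real.exp (2 * s)) (Real.exp (2 * s) * (2 * 1)) s :=
    fun s => ((hasDerivAt_id s).const_mul 2).exp
  have hv : Continuous fun t => Sobolev.comp 2 0 (V.1 t) :=
    (Sobolev.comp 2 0).continuous.comp V.2.1.continuous
  have hv' : Continuous fun t => Sobolev.comp 2 0 (deriv V.1 t) :=
    (Sobolev.comp 2 0).continuous.comp (Trajectory.continuous_deriv V)
  have hd : ∀ t, HasDerivAt (fun t => Real.exp (2 * t) * ⟪Sobolev.comp 2 0 (V.1 t), Φ t⟫)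
      (Real.exp (2 * t) * (2 * 1) * ⟪Sobolev.comp 2 0 (V.1 t), Φ t⟫ + Real.exp (2 * t) *
        (⟪Sobolev.comp 2 0 (V.1 t), Φt t⟫ + ⟪Sobolev.comp 2 0 (deriv V.1 t), Φ t⟫)) t := fun t =>
    (he t).mul (((Sobolev.comp 2 0).hasFDerivAt.comp_hasDerivAt t
      (Trajectory.hasDerivAt V t)).inner ℝ (hΦ.hasDerivAt t))
  have hdc : Continuous fun t => Real.exp (2 * t) * (2 * 1) * ⟪Sobolev.comp 2 0 (V.1 t), Φ t⟫ +
      Real.exp (2 * t) * (⟪Sobolev.comp 2 0 (V.1 t), Φt t⟫ +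
        ⟪Sobolev.comp 2 0 (deriv V.1 t), Φ t⟫) :=
    ((hec.mul continuous_const).mul (hv.inner hΦ.continuous)).add
      (hec.mul ((hv.inner hΦ.continuous_time).add (hv'.inner hΦ.continuous)))
  have hr : IntervalIntegrable (fun t => Real.exp (2 * t) *
      ⟪Trajectory.source (fun t => cutoff (c t)) V t, Φ t⟫) volume 0 T := by
    have h1 : IntervalIntegrable (Trajectory.source (fun t => cutoff (c t)) V) volume 0 T := by
      rw [intervalIntegrable_iff_integrableOn_Ioc_of_le hT]
      have hsub : Ioc 0 T ⊆ Ici (0 : ℝ) := fun s hs => hs.1.le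
      exact ((Trajectory.memLp_source (preservesMemLp_cutoff hc) V).mono_measure
        (Measure.restrict_mono_set _ hsub)).integrable (by norm_num)
    exact (h1.inner_continuousOn hΦ.continuous.continuousOn).continuousOn_mul hec.continuousOn
  -- Applied to e^{2t}⟪V, Φ⟫: the term produced by differentiating the exponential cancels the 2V in
  -- the source.
  have hftc := intervalIntegral.integral_eq_sub_of_hasDerivAt (a := 0) (b := T)
    (fun t _ => hd t) (hdc.intervalIntegrable 0 T)
  simp only [mul_zero, Real.exp_zero, one_mul] at hftc
  rw [← hftc, ← intervalIntegral.integral_sub (hdc.intervalIntegrable 0 T) hr]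
  refine intervalIntegral.integral_congr fun t _ => ?_
  have h2 := hΦ.inner_comp_two (V.1 t) t
  simp only [Trajectory.comp_zero_deriv (fun t => cutoff (c t)) V t, inner_add_left,
    inner_sub_left, inner_add_right, real_inner_smul_left, real_inner_smul_right, h2]
  ring

/-- Limit of the identity for trajectories: dominated convergence on the left, pointwise convergence
at the endpoints, and Cauchy–Schwarz for the source, whose L² norm tends to zero. -/
theorem IsApproximation.integral_eq_sub {c : ℝ → ℝ} {u₀ : Sobolev 1} {V : ℕ → Trajectory}
    {v : ℝ → Sobolev 1} {w : Lp (Sobolev 2) 2 halfLine} {δ : ℕ → ℝ}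
    (h : IsApproximation c u₀ V v w δ) (hc : AEMeasurable c halfLine)
    {φ : ℝ → ℝ → ℝ} {Φ Φt Φxx : ℝ → L2R} (hΦ : IsTestCurve c φ Φ Φt Φxx) {T : ℝ} (hT : 0 ≤ T) :
    ∫ t in (0 : ℝ)..T, Real.exp (2 * t) *
        (⟪Sobolev.comp 1 0 (v t), Φt t + (1 / 2 : ℝ) • Φxx t⟫
          - ⟪cutoff (c t) (Sobolev.comp 1 0 (v t)), Φ t⟫) =
      Real.exp (2 * T) * ⟪Sobolev.comp 1 0 (v T), Φ T⟫ - ⟪Sobolev.comp 1 0 u₀, Φ 0⟫ := by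
  have hec : Continuous fun s : ℝ => Real.exp (2 * s) := by fun_prop
  have hpt : ∀ t, 0 ≤ t → Tendsto (fun n => Sobolev.comp 2 0 ((V n).1 t)) atTop
      (𝓝 (Sobolev.comp 1 0 (v t))) := fun t ht =>
    ((Sobolev.comp 1 0).continuous.tendsto _).comp (h.tendsto_incl ht)
  obtain ⟨D, hD⟩ := h.tendsto_zero.bddAbove_range
  have hD' : ∀ n, δ n ≤ D := fun n => hD (mem_range_self n)
  -- All trajectories stay within 2D of the first one in H¹, which gives a dominating function that
  -- is continuous in t.
  have hvb : ∀ n t, 0 ≤ t →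
      ‖Sobolev.comp 2 0 ((V n).1 t)‖ ≤ ‖Sobolev.incl ((V 0).1 t)‖ + 2 * D := by
    intro n t ht
    have h1 := h.norm_sub_le n t ht
    have h2 := h.norm_sub_le 0 t ht
    have h3 : ‖Sobolev.comp 2 0 ((V n).1 t)‖ ≤ ‖Sobolev.incl ((V n).1 t)‖ :=
      Sobolev.norm_comp_le 0 (Sobolev.incl ((V n).1 t))
    have h4 : ‖Sobolev.incl ((V n).1 t)‖ ≤ ‖Sobolev.incl ((V 0).1 t)‖ +
        (‖Sobolev.incl ((V n).1 t) - v t‖ + ‖Sobolev.incl ((V 0).1 t) - v t‖) := by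
      have e : Sobolev.incl ((V n).1 t) = Sobolev.incl ((V 0).1 t) +
        ((Sobolev.incl ((V n).1 t) - v t) - (Sobolev.incl ((V 0).1 t) - v t)) := by abel
      calc ‖Sobolev.incl ((V n).1 t)‖ = ‖Sobolev.incl ((V 0).1 t) +
            ((Sobolev.incl ((V n).1 t) - v t) - (Sobolev.incl ((V 0).1 t) - v t))‖ := by rw [← e]
        _ ≤ _ := (norm_add_le _ _).trans (by gcongr; exact _root_.norm_sub_le _ _)
    linarith [hD' n, hD' 0]
  have hleft : Tendsto (fun n => ∫ t in (0 : ℝ)..T, Real.exp (2 * t) *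
        (⟪Sobolev.comp 2 0 ((V n).1 t), Φt t + (1 / 2 : ℝ) • Φxx t⟫
          - ⟪cutoff (c t) (Sobolev.comp 2 0 ((V n).1 t)), Φ t⟫)) atTop
      (𝓝 (∫ t in (0 : ℝ)..T, Real.exp (2 * t) *
        (⟪Sobolev.comp 1 0 (v t), Φt t + (1 / 2 : ℝ) • Φxx t⟫
          - ⟪cutoff (c t) (Sobolev.comp 1 0 (v t)), Φ t⟫))) := by
    have hΨ : Continuous fun t => Φt t + (1 / 2 : ℝ) • Φxx t := by
      have h1 := hΦ.continuous_time
      have h2 := hΦ.continuous_space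
      fun_prop
    refine intervalIntegral.tendsto_integral_filter_of_dominated_convergence
      (fun t => Real.exp (2 * t) * ((‖Sobolev.incl ((V 0).1 t)‖ + 2 * D) *
        (‖Φt t + (1 / 2 : ℝ) • Φxx t‖ + ‖Φ t‖))) (Eventually.of_forall fun n => ?_)
      (Eventually.of_forall fun n => Eventually.of_forall fun t ht => ?_) ?_
      (Eventually.of_forall fun t ht => ?_)
    · have hv : Continuous fun t => Sobolev.comp 2 0 ((V n).1 t) :=
        (Sobolev.comp 2 0).continuous.comp (V n).2.1.continuous
      have hsub : uIoc 0 T ⊆ Ici (0 : ℝ) := fun s hs => by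
        rw [uIoc_of_le hT] at hs
        exact hs.1.le
      exact hec.aestronglyMeasurable.mul ((hv.inner hΨ).aestronglyMeasurable.sub
        ((hv.aestronglyMeasurable.cutoff (hc.mono_measure
          (Measure.restrict_mono_set _ hsub))).inner hΦ.continuous.aestronglyMeasurable))
    · rw [uIoc_of_le hT] at ht
      have hb := hvb n t ht.1.le
      rw [norm_mul, Real.norm_of_nonneg (Real.exp_pos _).le, mul_add]
      refine mul_le_mul_of_nonneg_left ((_root_.norm_sub_le _ _).trans (add_le_add ?_ ?_))
        (Real.exp_pos _).le
      · exact (norm_inner_le_norm _ _).trans (by gcongr)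
      · exact (norm_inner_le_norm _ _).trans (by
          gcongr
          exact (norm_cutoff_le _ _).trans hb)
    · exact Continuous.intervalIntegrable (hec.mul
        (((Sobolev.incl.continuous.comp (V 0).2.1.continuous).norm.add continuous_const).mul
          (hΨ.norm.add hΦ.continuous.norm))) 0 T
    · rw [uIoc_of_le hT] at ht
      have h1 := hpt t ht.1.le
      exact ((h1.inner tendsto_const_nhds).sub
        ((((cutoff (c t)).continuous.tendsto _).comp h1).inner tendsto_const_nhds)).const_mul _
  have hright : Tendsto (fun n => Real.exp (2 * T) * ⟪Sobolev.comp 2 0 ((V n).1 T), Φ T⟫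
        - ⟪Sobolev.comp 2 0 ((V n).1 0), Φ 0⟫ - ∫ t in (0 : ℝ)..T,
          Real.exp (2 * t) * ⟪Trajectory.source (fun t => cutoff (c t)) (V n) t, Φ t⟫) atTop
      (𝓝 (Real.exp (2 * T) * ⟪Sobolev.comp 1 0 (v T), Φ T⟫ - ⟪Sobolev.comp 1 0 u₀, Φ 0⟫ - 0)) := by
    have h0 := hpt 0 le_rfl
    rw [h.initial] at h0
    refine ((((hpt T hT).inner tendsto_const_nhds).const_mul _).sub
      (h0.inner tendsto_const_nhds)).sub ?_
    obtain ⟨R, hR⟩ := hΦ.eventually_zero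
    have hΦL : MemLp Φ 2 halfLine := hΦ.continuous.memLp_halfLine hR
    refine squeeze_zero_norm (a := fun n => Real.exp (2 * T) * (δ n * ‖hΦL.toLp‖)) (fun n => ?_) ?_
    · have hF := Trajectory.memLp_source (preservesMemLp_cutoff hc) (V n)
      have hsub : Ioc 0 T ⊆ Ici (0 : ℝ) := fun s hs => hs.1.le
      have hFi : Integrable (fun t =>
          ‖Trajectory.source (fun t => cutoff (c t)) (V n) t‖ * ‖Φ t‖) halfLine :=
        hF.norm.integrable_mul hΦL.norm
      have hFδ : ‖hF.toLp‖ ≤ δ n := by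
        refine (sq_le_sq₀ (norm_nonneg _) (h.nonneg n)).1 ?_
        rw [hF.norm_sq_toLp]
        exact h.integral_source_le n
      calc ‖∫ t in (0 : ℝ)..T, Real.exp (2 * t) *
            ⟪Trajectory.source (fun t => cutoff (c t)) (V n) t, Φ t⟫‖
          ≤ ∫ t in Ioc 0 T, Real.exp (2 * T) *
            (‖Trajectory.source (fun t => cutoff (c t)) (V n) t‖ * ‖Φ t‖) := by
            rw [intervalIntegral.integral_of_le hT]
            refine norm_integral_le_of_norm_le
              ((IntegrableOn.mono_set hFi hsub).const_mul _) ?_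
            filter_upwards [ae_restrict_mem measurableSet_Ioc] with t ht
            rw [norm_mul, Real.norm_of_nonneg (Real.exp_pos _).le]
            gcongr
            · exact ht.2
            · exact norm_inner_le_norm _ _
        _ ≤ ∫ t, Real.exp (2 * T) *
            (‖Trajectory.source (fun t => cutoff (c t)) (V n) t‖ * ‖Φ t‖) ∂halfLine :=
            setIntegral_mono_set (hFi.const_mul _)
              (Eventually.of_forall fun t => by simp only [Pi.zero_apply]; positivity)
              (Eventually.of_forall hsub)
        _ ≤ Real.exp (2 * T) * (δ n * ‖hΦL.toLp‖) := by
            rw [integral_const_mul]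
            gcongr
            exact (hF.integral_norm_mul_norm_le hΦL).trans (by gcongr)
    · have := (h.tendsto_zero.mul_const ‖hΦL.toLp‖).const_mul (Real.exp (2 * T))
      simpa using this
  rw [sub_zero] at hright
  refine tendsto_nhds_unique hleft (hright.congr fun n => ?_)
  exact (Trajectory.integral_eq_sub hc (V n) hΦ hT).symm

/-- The weak formulation in terms of inner products in `L²(ℝ)`. -/
theorem isWeakSolution_iff_at {c : ℝ → ℝ} {u₀ : Sobolev 1} {u : ℝ → Sobolev 1}
    {φ : ℝ → ℝ → ℝ} {Φ Φt Φxx : ℝ → L2R} (hΦ : IsTestCurve c φ Φ Φt Φxx) (T : ℝ) :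
    (∫ t in (0 : ℝ)..T, ∫ x, Sobolev.fn (u t) x * deriv (fun s => φ s x) t =
      (∫ x, Sobolev.fn (u T) x * φ T x) - (∫ x, Sobolev.fn u₀ x * φ 0 x)
        - (1 / 2) * (∫ t in (0 : ℝ)..T, ∫ x, Sobolev.fn (u t) x * iteratedDeriv 2 (φ t) x)
        + ∫ t in (0 : ℝ)..T, ∫ x, killing c t x * Sobolev.fn (u t) x * φ t x) ↔
    ∫ t in (0 : ℝ)..T, ⟪Sobolev.comp 1 0 (u t), Φt t⟫ =
      ⟪Sobolev.comp 1 0 (u T), Φ T⟫ - ⟪Sobolev.comp 1 0 u₀, Φ 0⟫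
        - (1 / 2) * (∫ t in (0 : ℝ)..T, ⟪Sobolev.comp 1 0 (u t), Φxx t⟫)
        + ∫ t in (0 : ℝ)..T, ⟪cutoff (c t) (Sobolev.comp 1 0 (u t)), Φ t⟫ := by
  simp only [hΦ.inner_cutoff]
  simp only [hΦ.inner_eq, hΦ.inner_time, hΦ.inner_space]
  exact Iff.rfl

theorem continuous_exp_two_mul : Continuous fun t : ℝ => Real.exp (2 * t) := by fun_prop

theorem IsApproximation.isSolution {c : ℝ → ℝ} {u₀ : Sobolev 1} {V : ℕ → Trajectory}
    {v : ℝ → Sobolev 1} {w : Lp (Sobolev 2) 2 halfLine} {δ : ℕ → ℝ}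
    (h : IsApproximation c u₀ V v w δ) (hc : AEMeasurable c halfLine) :
    IsSolution c u₀ fun t => Real.exp (2 * t) • v t where
  continuousOn := (continuous_exp_two_mul.continuousOn).smul h.continuousOn
  memL2H2 := h.memL2H2
  initial := by simp [h.initial]
  weak := by
    intro T hT φ hφ hφc
    obtain ⟨Φ, Φt, Φxx, hΦ⟩ := exists_isTestCurve c hφ hφc
    refine (isWeakSolution_iff_at hΦ T).2 ?_
    have key := h.integral_eq_sub hc hΦ hT.le
    set f : ℝ → L2R := fun t => Sobolev.comp 1 0 (Real.exp (2 * t) • v t) with hf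
    have hfe : ∀ t, f t = Real.exp (2 * t) • Sobolev.comp 1 0 (v t) := fun t => map_smul _ _ _
    have hfc : ContinuousOn f (Icc 0 T) :=
      (Sobolev.comp 1 0).continuous.comp_continuousOn
        (continuous_exp_two_mul.continuousOn.smul (h.continuousOn.mono Icc_subset_Ici_self))
    have hfi : IntervalIntegrable f volume 0 T :=
      ContinuousOn.intervalIntegrable (by rwa [uIcc_of_le hT.le])
    have i1 := hfi.inner_continuousOn hΦ.continuous_time.continuousOn
    have i2 := hfi.inner_continuousOn hΦ.continuous_space.continuousOn
    have i3 := (intervalIntegrable_cutoff hc hT.le hfc).inner_continuousOn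
      hΦ.continuous.continuousOn
    have e : ∫ t in (0 : ℝ)..T, Real.exp (2 * t) *
        (⟪Sobolev.comp 1 0 (v t), Φt t + (1 / 2 : ℝ) • Φxx t⟫
          - ⟪cutoff (c t) (Sobolev.comp 1 0 (v t)), Φ t⟫) =
        (∫ t in (0 : ℝ)..T, ⟪f t, Φt t⟫) + 1 / 2 * (∫ t in (0 : ℝ)..T, ⟪f t, Φxx t⟫)
          - ∫ t in (0 : ℝ)..T, ⟪cutoff (c t) (f t), Φ t⟫ := by
      rw [← intervalIntegral.integral_const_mul, ← intervalIntegral.integral_add i1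
        (i2.const_mul _), ← intervalIntegral.integral_sub (i1.add (i2.const_mul _)) i3]
      refine intervalIntegral.integral_congr fun t _ => ?_
      simp only [hfe, map_smul, inner_add_right, real_inner_smul_left, real_inner_smul_right]
      ring
    rw [e] at key
    have h3 : ⟪f T, Φ T⟫ = Real.exp (2 * T) * ⟪Sobolev.comp 1 0 (v T), Φ T⟫ := by
      rw [hfe, real_inner_smul_left]
    change ∫ t in (0 : ℝ)..T, ⟪f t, Φt t⟫ = ⟪f T, Φ T⟫ - ⟪Sobolev.comp 1 0 u₀, Φ 0⟫
        - (1 / 2) * (∫ t in (0 : ℝ)..T, ⟪f t, Φxx t⟫)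
        + ∫ t in (0 : ℝ)..T, ⟪cutoff (c t) (f t), Φ t⟫
    rw [h3]
    linarith

/-! ### Uniqueness and the main theorem -/

theorem exists_smooth_eq_one (T : ℝ) : ∃ χ : ℝ → ℝ, ContDiff ℝ ∞ χ ∧ HasCompactSupport χ ∧
    ∀ t ∈ Icc 0 T, χ =ᶠ[𝓝 t] fun _ => 1 := by
  set b : ContDiffBump (0 : ℝ) := ⟨|T| + 1, |T| + 2, by positivity, by linarith⟩
  refine ⟨b, b.contDiff, b.hasCompactSupport, fun t ht => ?_⟩
  have hmem : t ∈ Metric.ball (0 : ℝ) (|T| + 1) := by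
    rw [mem_ball_zero_iff, Real.norm_of_nonneg ht.1]
    linarith [ht.2, le_abs_self T]
  filter_upwards [Metric.isOpen_ball.mem_nhds hmem] with s hs
  exact b.one_of_mem_closedBall (Metric.ball_subset_closedBall hs)

/-- A test function of x alone is not compactly supported in time, so it is multiplied by a bump χ
equal to 1 near each point of [0,T]. Equality near the endpoints makes the time derivative vanish
there as well. -/
theorem IsWeakSolution.test_space {c : ℝ → ℝ} {u₀ : Sobolev 1} {u : ℝ → Sobolev 1}
    (h : IsWeakSolution c u₀ u) {T : ℝ} (hT : 0 < T) {η : ℝ → ℝ} (hη : ContDiff ℝ ∞ η)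
    (hηc : HasCompactSupport η) :
    0 = (∫ x, Sobolev.fn (u T) x * η x) - (∫ x, Sobolev.fn u₀ x * η x)
        - (1 / 2) * (∫ t in (0 : ℝ)..T, ∫ x, Sobolev.fn (u t) x * iteratedDeriv 2 η x)
        + ∫ t in (0 : ℝ)..T, ∫ x, killing c t x * Sobolev.fn (u t) x * η x := by
  obtain ⟨χ, hχ, hχc, hχ1⟩ := exists_smooth_eq_one T
  have hval : ∀ t ∈ Icc 0 T, (fun x => χ t * η x) = η := fun t ht => by
    funext x
    rw [(hχ1 t ht).self_of_nhds, one_mul]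
  have hcs : HasCompactSupport (Function.uncurry fun t x => χ t * η x) := by
    refine HasCompactSupport.intro (hχc.isCompact.prod hηc.isCompact) ?_
    rintro ⟨t, x⟩ htx
    rw [mem_prod, not_and_or] at htx
    rcases htx with htx | htx
    · simp [image_eq_zero_of_notMem_tsupport htx]
    · simp [image_eq_zero_of_notMem_tsupport htx]
  have key := h T hT (fun t x => χ t * η x)
    ((hχ.comp contDiff_fst).mul (hη.comp contDiff_snd)) hcs
  have e0 : ∫ t in (0 : ℝ)..T, ∫ x, Sobolev.fn (u t) x * deriv (fun s => χ s * η x) t = 0 := by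
    refine (intervalIntegral.integral_congr (g := fun _ => (0 : ℝ)) fun t ht => ?_).trans (by simp)
    rw [uIcc_of_le hT.le] at ht
    have hd : ∀ x, deriv (fun s => χ s * η x) t = 0 := fun x => by
      have : (fun s => χ s * η x) =ᶠ[𝓝 t] fun _ => 1 * η x := by
        filter_upwards [hχ1 t ht] with s hs
        rw [hs]
      rw [this.deriv_eq, deriv_const]
    simp [hd]
  have e1 : ∫ t in (0 : ℝ)..T, ∫ x, Sobolev.fn (u t) x * iteratedDeriv 2 (fun x => χ t * η x) x =
      ∫ t in (0 : ℝ)..T, ∫ x, Sobolev.fn (u t) x * iteratedDeriv 2 η x := by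
    refine intervalIntegral.integral_congr fun t ht => ?_
    rw [uIcc_of_le hT.le] at ht
    simp only [hval t ht]
  have e2 : ∫ t in (0 : ℝ)..T, ∫ x, killing c t x * Sobolev.fn (u t) x * (χ t * η x) =
      ∫ t in (0 : ℝ)..T, ∫ x, killing c t x * Sobolev.fn (u t) x * η x := by
    refine intervalIntegral.integral_congr fun t ht => ?_
    rw [uIcc_of_le hT.le] at ht
    simp only [(hχ1 t ht).self_of_nhds, one_mul]
  have hT1 : χ T = 1 := (hχ1 T ⟨hT.le, le_rfl⟩).self_of_nhds
  have h01 : χ 0 = 1 := (hχ1 0 ⟨le_rfl, hT.le⟩).self_of_nhds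
  rw [e0, e1, e2] at key
  simpa only [hT1, h01, one_mul] using key

/-- The right-hand side `½ ∂ₓ²u - ψ u` of the evolution equation. -/
noncomputable def velocity (c : ℝ → ℝ) (u : ℝ → Sobolev 1) (w : ℝ → Sobolev 2) (t : ℝ) : L2R :=
  (1 / 2 : ℝ) • Sobolev.comp 2 2 (w t) - cutoff (c t) (Sobolev.comp 1 0 (u t))

theorem IsSolution.continuousOn_comp {c : ℝ → ℝ} {u₀ : Sobolev 1} {u : ℝ → Sobolev 1}
    (h : IsSolution c u₀ u) (T : ℝ) : ContinuousOn (fun t => Sobolev.comp 1 0 (u t)) (Icc 0 T) :=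
  (Sobolev.comp 1 0).continuous.comp_continuousOn (h.continuousOn.mono Icc_subset_Ici_self)

theorem intervalIntegrable_comp_two {w : ℝ → Sobolev 2}
    (hw : ∀ T : ℝ, 0 < T → MemLp w 2 (volume.restrict (Icc 0 T))) {T : ℝ} (hT : 0 < T) :
    IntervalIntegrable (fun t => Sobolev.comp 2 2 (w t)) volume 0 T := by
  rw [intervalIntegrable_iff_integrableOn_Icc_of_le hT.le]
  exact ((Sobolev.comp 2 2).comp_memLp' (hw T hT)).integrable (by norm_num)

theorem IsSolution.intervalIntegrable_velocity {c : ℝ → ℝ} (hc : AEMeasurable c halfLine)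
    {u₀ : Sobolev 1} {u : ℝ → Sobolev 1} (h : IsSolution c u₀ u) {w : ℝ → Sobolev 2}
    (hw : ∀ T : ℝ, 0 < T → MemLp w 2 (volume.restrict (Icc 0 T))) {T : ℝ} (hT : 0 < T) :
    IntervalIntegrable (velocity c u w) volume 0 T :=
  ((intervalIntegrable_comp_two hw hT).smul (1 / 2 : ℝ)).sub
    (intervalIntegrable_cutoff hc hT.le (h.continuousOn_comp T))

/-- A weak solution solves the equation as an integral equation in `L²(ℝ)`. -/
theorem IsSolution.eq_add_integral {c : ℝ → ℝ} (hc : AEMeasurable c halfLine)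
    {u₀ : Sobolev 1} {u : ℝ → Sobolev 1} (h : IsSolution c u₀ u) {w : ℝ → Sobolev 2}
    (huw : IsH2Version u w) (hw : ∀ T : ℝ, 0 < T → MemLp w 2 (volume.restrict (Icc 0 T)))
    {T : ℝ} (hT : 0 < T) :
    Sobolev.comp 1 0 (u T) = Sobolev.comp 1 0 u₀ + ∫ t in (0 : ℝ)..T, velocity c u w t := by
  rw [← sub_eq_zero]
  refine L2R.eq_zero_of_forall_inner_ofTest _ fun η hη hηc => ?_
  set k := L2R.ofTest η hη.continuous hηc
  have key := h.weak.test_space hT hη hηc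
  have hk : ∀ f : L2R, ⟪f, k⟫ = ∫ x, f x * η x := fun f => L2R.inner_ofTest f _ _
  have i1 : IntervalIntegrable (fun t => ⟪Sobolev.comp 2 2 (w t), k⟫) volume 0 T :=
    (intervalIntegrable_comp_two hw hT).inner_continuousOn continuousOn_const
  have i2 : IntervalIntegrable (fun t => ⟪cutoff (c t) (Sobolev.comp 1 0 (u t)), k⟫) volume 0 T :=
    (intervalIntegrable_cutoff hc hT.le (h.continuousOn_comp T)).inner_continuousOn
      continuousOn_const
  have e1 : ∫ t in (0 : ℝ)..T, ∫ x, Sobolev.fn (u t) x * iteratedDeriv 2 η x =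
      ∫ t in (0 : ℝ)..T, ⟪Sobolev.comp 2 2 (w t), k⟫ := by
    rw [intervalIntegral.integral_of_le hT.le, intervalIntegral.integral_of_le hT.le]
    refine integral_congr_ae ?_
    have hsub : Ioc 0 T ⊆ Ici (0 : ℝ) := fun s hs => hs.1.le
    filter_upwards [ae_restrict_of_ae_restrict_of_subset hsub huw] with t ht
    rw [Sobolev.inner_comp_two_ofTest (w t) hη hηc, ← Sobolev.fn_eq_comp, ht]
  have e2 : ∫ t in (0 : ℝ)..T, ∫ x, killing c t x * Sobolev.fn (u t) x * η x =
      ∫ t in (0 : ℝ)..T, ⟪cutoff (c t) (Sobolev.comp 1 0 (u t)), k⟫ :=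
    intervalIntegral.integral_congr fun t _ => (inner_cutoff_ofTest c t _ _ _).symm
  have e3 : ⟪∫ t in (0 : ℝ)..T, velocity c u w t, k⟫ =
      1 / 2 * (∫ t in (0 : ℝ)..T, ⟪Sobolev.comp 2 2 (w t), k⟫)
        - ∫ t in (0 : ℝ)..T, ⟪cutoff (c t) (Sobolev.comp 1 0 (u t)), k⟫ := by
    have h1 := (innerSL ℝ k).intervalIntegral_comp_comm (h.intervalIntegrable_velocity hc hw hT)
    simp only [innerSL_apply_apply] at h1
    rw [real_inner_comm, ← h1, ← intervalIntegral.integral_const_mul,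
      ← intervalIntegral.integral_sub (i1.const_mul _) i2]
    refine intervalIntegral.integral_congr fun t _ => ?_
    simp only [velocity, inner_sub_right, real_inner_smul_right, real_inner_comm k]
  rw [e1, e2] at key
  rw [inner_sub_left, inner_add_left, e3, hk, hk]
  change _ = ((∫ x, Sobolev.comp 1 0 (u T) x * η x) - ∫ x, Sobolev.comp 1 0 u₀ x * η x) - _ + _
    at key
  linarith

/-- The energy argument is run in L² only: the difference is absolutely continuous there, its
velocity pairs with it to -½‖∂ₓd‖² - ‖ψd‖² almost everywhere, and equality in L² gives equality in
H¹. -/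
theorem IsSolution.eqOn {c : ℝ → ℝ} (hc : AEMeasurable c halfLine) {u₀ : Sobolev 1}
    {u u' : ℝ → Sobolev 1} (h : IsSolution c u₀ u) (h' : IsSolution c u₀ u') :
    EqOn u u' (Ici 0) := by
  obtain ⟨w, huw, hw⟩ := h.memL2H2
  obtain ⟨w', huw', hw'⟩ := h'.memL2H2
  have hpos : ∀ T : ℝ, 0 < T → u T = u' T := by
    intro T hT
    set d : ℝ → L2R := fun t => Sobolev.comp 1 0 (u t) - Sobolev.comp 1 0 (u' t) with hd
    set g : ℝ → L2R := fun t => velocity c u w t - velocity c u' w' t with hg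
    have hd0 : d 0 = 0 := by simp [hd, h.initial, h'.initial]
    have hgi : IntervalIntegrable g volume 0 T :=
      (h.intervalIntegrable_velocity hc hw hT).sub (h'.intervalIntegrable_velocity hc hw' hT)
    have hdg : ∀ t ∈ Icc 0 T, d t = d 0 + ∫ s in (0 : ℝ)..t, g s := by
      intro t ht
      rcases ht.1.eq_or_lt with rfl | ht0
      · simp
      · rw [hd0, zero_add, hg, intervalIntegral.integral_sub
          (h.intervalIntegrable_velocity hc hw ht0) (h'.intervalIntegrable_velocity hc hw' ht0), hd]
        simp only
        rw [h.eq_add_integral hc huw hw ht0, h'.eq_add_integral hc huw' hw' ht0]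
        abel
    have hE := integral_inner_add_inner_eq_sub hT.le hgi hdg hgi hdg
    have hle : ∫ t in (0 : ℝ)..T, (⟪d t, g t⟫ + ⟪g t, d t⟫) ≤ 0 := by
      rw [intervalIntegral.integral_of_le hT.le]
      refine integral_nonpos_of_ae ?_
      have hsub : Ioc 0 T ⊆ Ici (0 : ℝ) := fun s hs => hs.1.le
      filter_upwards [ae_restrict_of_ae_restrict_of_subset hsub huw,
        ae_restrict_of_ae_restrict_of_subset hsub huw'] with t h1 h2
      have h1' : Sobolev.comp 1 0 (u t) = Sobolev.comp 2 0 (w t) := h1.symm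
      have h2' : Sobolev.comp 1 0 (u' t) = Sobolev.comp 2 0 (w' t) := h2.symm
      have hdt : d t = Sobolev.comp 2 0 (w t - w' t) := by
        rw [map_sub, ← h1', ← h2']
      have hgt : g t = (1 / 2 : ℝ) • Sobolev.comp 2 2 (w t - w' t) - cutoff (c t) (d t) := by
        simp only [hg, hd, velocity, map_sub, smul_sub]
        abel
      have h3 := Sobolev.norm_comp_one_sq (w t - w' t)
      rw [← hdt] at h3
      have h4 := inner_cutoff_self (c t) (d t)
      have h5 : ⟪d t, g t⟫ ≤ 0 := by
        rw [hgt, inner_sub_right, real_inner_smul_right, h4, real_inner_comm]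
        nlinarith [sq_nonneg ‖Sobolev.comp 2 1 (w t - w' t)‖, sq_nonneg ‖cutoff (c t) (d t)‖]
      rw [real_inner_comm (d t)]
      exact add_nonpos h5 h5
    rw [hE, hd0, inner_zero_left, sub_zero, real_inner_self_eq_norm_sq] at hle
    have hz : d T = 0 := by
      have : ‖d T‖ ^ 2 = 0 := le_antisymm hle (sq_nonneg _)
      simpa using this
    exact Sobolev.fn_injective 1 (sub_eq_zero.1 hz)
  intro t ht
  rcases (mem_Ici.1 ht).eq_or_lt with rfl | ht0
  · rw [h.initial, h'.initial]
  · exact hpos t ht0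

theorem mainTheorem7 (c : ℝ → ℝ) (hc : AEMeasurable c (volume.restrict (Ici (0 : ℝ))))
    (u₀ : Sobolev 1) :
    (∃ u : ℝ → Sobolev 1, IsSolution c u₀ u ∧
      ∀ v : ℝ → Sobolev 1, IsSolution c u₀ v → EqOn v u (Ici 0)) ∧
    (∀ u : ℝ → Sobolev 1, IsSolution c u₀ u →
      ∀ w : ℝ → Sobolev 2, IsH2Version u w → ∀ T : ℝ, 0 < T →
        (⨆ t ∈ Icc (0 : ℝ) T, ‖u t‖ₑ)
          + (∫⁻ t in Icc (0 : ℝ) T, ‖Sobolev.dx (w t)‖ₑ ^ 2) ^ (1 / 2 : ℝ) ≤ 3 * ‖u₀‖ₑ) := by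
  obtain ⟨V, v, w₀, δ, h⟩ := exists_isApproximation hc u₀
  have hsol := h.isSolution hc
  refine ⟨⟨_, hsol, fun u hu => hu.eqOn hc hsol⟩, fun u hu w huw T hT => ?_⟩
  -- Any solution is the constructed one, and an H² version is determined almost everywhere by the
  -- underlying function, so both bounds carry over.
  have hEq := hu.eqOn hc hsol
  have hsup : (⨆ t ∈ Icc (0 : ℝ) T, ‖u t‖ₑ) ≤ ‖u₀‖ₑ := by
    refine iSup₂_le fun t ht => ?_
    rw [hEq ht.1]
    exact enorm_le_iff_norm_le.2 (h.norm_le hc ht.1)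
  have hint : ∫⁻ t in Icc (0 : ℝ) T, ‖Sobolev.dx (w t)‖ₑ ^ 2 ≤ (2 * ‖u₀‖ₑ) ^ 2 := by
    have e : ∫⁻ t in Icc (0 : ℝ) T, ‖Sobolev.dx (w t)‖ₑ ^ 2 =
        ∫⁻ t in Icc (0 : ℝ) T, ‖Sobolev.dx (Real.exp (2 * t) • w₀ t)‖ₑ ^ 2 := by
      refine lintegral_congr_ae ?_
      have hsub : Icc 0 T ⊆ Ici (0 : ℝ) := Icc_subset_Ici_self
      filter_upwards [ae_restrict_of_ae_restrict_of_subset hsub huw,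
        ae_restrict_of_ae_restrict_of_subset hsub h.isH2Version,
        ae_restrict_mem measurableSet_Icc] with t h1 h2 ht
      rw [Sobolev.fn_injective 2 (h1.trans ((congrArg Sobolev.fn (hEq ht.1)).trans h2.symm))]
    rw [e, mul_pow]
    refine (h.lintegral_dx_le hc hT.le).trans_eq ?_
    norm_num
  calc (⨆ t ∈ Icc (0 : ℝ) T, ‖u t‖ₑ) +
        (∫⁻ t in Icc (0 : ℝ) T, ‖Sobolev.dx (w t)‖ₑ ^ 2) ^ (1 / 2 : ℝ)
      ≤ ‖u₀‖ₑ + ((2 * ‖u₀‖ₑ) ^ 2) ^ (1 / 2 : ℝ) := by gcongr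
    _ = 3 * ‖u₀‖ₑ := by
        rw [← ENNReal.rpow_natCast, ← ENNReal.rpow_mul]
        norm_num
        ring
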